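/- **Setting.** There are $n\ge 1$ markets. An environment is a sequence $D_1,D_2,\dots$, fixed in advance, of (measurable) maps $D_t:[0,1]^{n+1}\to\Delta([0,1]^n)$. In round $t$ the firm chooses costs $c_t=(c_{t,1},\dots,c_{t,n})\in[0,1]^n$ and a common price $p_t\in[0,1]$ and observes demands $d_t=(d_{t,1},\dots,d_{t,n})$, where $d_t\sim D_t(c_t,p_t)$ given the past and $(c_t,p_t)$. The mean of $d_{t,i}$ under $D_t(c,p)$ depends only on $(c_i,p)$ and is written $\overline d_{t,i}(c_i,p)$. The regret is $$R_T=\sup_{(c,p)\in[0,1]^{n+1}}\sum_{t=1}^T\sum_{i=1}^n\bigl(p\,\overline d_{t,i}(c_i,p)-c_i\bigr)-\mathbb E\Bigl[\sum_{t=1}^T\sum_{i=1}^n\bigl(p_td_{t,i}-c_{t,i}\bigr)\Bigr].$$ Demands are *cost-concave* if, for all $t\le T$ and all $i$, $\overline d_{t,i}(c_i,p)$ is concave in $c_i\in[0,1]$ and non-increasing in $p\in[0,1]$. **Algorithm.** Inputs: $\eta,\gamma,\epsilon,\delta>0$ and an integer $K\ge1$. Let $\mathcal I_\delta=[\delta,1-\delta]$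 and $\mathcal I_K=\{0,1/K,\dots,1\}$. For a probability density $u$ on $\mathcal I_\delta$ with mean $\mu$, let $$K_\epsilon[u](x,y)=\begin{cases}|y-\mu|^{-1}\,\mathbb 1[\min(y,\mu)\le x\le\max(y,\mu)],&|y-\mu|\ge\epsilon,\\ \epsilon^{-1}\,\mathbb 1[\mu-\epsilon\le x\le\mu],&|y-\mu|<\epsilon,\ \mu\ge\epsilon+\delta,\\ \epsilon^{-1}\,\mathbb 1[\mu\le x\le\mu+\epsilon],&|y-\mu|<\epsilon,\ \mu<\epsilon+\delta.\end{cases}$$ Start with $q_{1,0}$ uniform on $\mathcal I_K$ and $u_{1,i}(\cdot|p)$ uniform on $\mathcal I_\delta$ for all $i\in\{1,\dots,n\}$ and $p\in\mathcal I_K$. In round $t$, let $q_{t,i}(x|p)=\int_{\mathcal I_\delta}K_\epsilon[u_{t,i}(\cdot|p)](x,y)\,u_{t,i}(y|p)\,dy$. Draw $p_t\sim q_{t,0}$ and then, independently for each $i$, $c_{t,i}$ with density $q_{t,i}(\cdot|p_t)$. Observe $d_t$, put $\ell_{t,i}=\frac12(1-p_td_{t,i}+c_{t,i})$ and $\ell_t=\sum_{i=1}^n\ell_{t,i}$,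 and for $p\in\mathcal I_K$ and $c\in\mathcal I_\delta$ let $$\widehat f_{t,i}(c,p)=\frac{\ell_{t,i}\,\mathbb 1[p_t=p]}{q_{t,i}(c_{t,i}|p_t)\,(q_{t,0}(p_t)+\gamma)}\,K_\epsilon[u_{t,i}(\cdot|p)](c_{t,i},c),$$ $$\widehat h_t(p)=\frac1n\cdot\frac{\ell_t\,\mathbb 1[p_t=p]}{q_{t,0}(p_t)+\gamma}+3\eta\log\frac e\epsilon\Bigl(\frac1\gamma-\frac1{q_{t,0}(p)+\gamma}\Bigr).$$ Update $u_{t+1,i}(c|p)\propto u_{t,i}(c|p)\,e^{-\eta\widehat f_{t,i}(c,p)}$ (normalized over $c\in\mathcal I_\delta$) and $q_{t+1,0}(p)\propto q_{t,0}(p)\,e^{-\eta\widehat h_t(p)}$ (normalized over $p\in\mathcal I_K$). **Theorem.** There is an absolute constant $C$ such that for all $n\ge1$, $T\ge3$, $K\ge1$, $\eta>0$ and every environment with cost-concave demands, the algorithm with $\epsilon=T^{-2}$, $\gamma=\eta\log(e/\epsilon)$ and $\delta=T^{-1}$ satisfies $$R_T\le C\Bigl(n\eta KT\log T+\frac n\eta\log(KT)+\frac{nT}K\Bigr).$$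 Moreover, if $K=\Theta(T^{1/3})$ and $\eta=\Theta(T^{-2/3})$, then $R_T=O(nT^{2/3}\log T)$. That is, for all constants $a,b>0$ and $A,B$ there is a constant $C'$, depending only on $a,A,b,B$, such that $R_T\le C'\,nT^{2/3}\log T$ for all $n\ge1$, $T\ge3$, every environment with cost-concave demands, and all $K,\eta$ with $aT^{1/3}\le K\le AT^{1/3}$ and $bT^{-2/3}\le\eta\le BT^{-2/3}$. -/

import Mathlib

open MeasureTheory ProbabilityTheory

namespace TargetedMarketing

noncomputable section

/-! ## The online problem -/

/-- An environment with `n` local markets: in round `t` the demand vector is drawn from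
`demand t (c, p)`, a distribution on `[0,1]^n` depending on the costs `c` and the common price `p`.
The expected demand in market `i` depends only on the cost `c i` of that market and on the price. -/
structure Environment (n : ℕ) where
  demand : ℕ → Kernel ((Fin n → unitInterval) × unitInterval) (Fin n → unitInterval)
  markov : ∀ t, IsMarkovKernel (demand t)
  mean_local : ∀ (t : ℕ) (i : Fin n) (p : unitInterval) (c c' : Fin n → unitInterval), c i = c' i →
    ∫ d, (d i : ℝ) ∂(demand t (c, p)) = ∫ d, (d i : ℝ) ∂(demand t (c', p))

attribute [instance] Environment.markov

/-- The expected demand of market `i` in round `t` at cost `x` (in that market) and price `p`. -/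
def Environment.meanDemand {n : ℕ} (E : Environment n) (t : ℕ) (i : Fin n)
    (x p : unitInterval) : ℝ :=
  ∫ d, (d i : ℝ) ∂(E.demand t (fun _ => x, p))

/-- Cost-concave demands in the first `T` rounds: the expected demands are concave in the cost and
non-increasing in the price. -/
def Environment.CostConcave {n : ℕ} (E : Environment n) (T : ℕ) : Prop :=
  ∀ t < T, ∀ i : Fin n,
    (∀ p : unitInterval, ConcaveOn ℝ (Set.Icc (0 : ℝ) 1)
      (Set.IccExtend zero_le_one (fun x : unitInterval => E.meanDemand t i x p))) ∧
    (∀ x : unitInterval, Antitone (fun p : unitInterval => E.meanDemand t i x p))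

/-- The best total expected profit over `T` rounds of fixed costs and a fixed common price. -/
def Environment.opt {n : ℕ} (E : Environment n) (T : ℕ) : ℝ :=
  ⨆ a : (Fin n → unitInterval) × unitInterval,
    ∑ t ∈ Finset.range T, ∑ i : Fin n,
      ((a.2 : ℝ) * E.meanDemand t i (a.1 i) a.2 - (a.1 i : ℝ))

/-! ## Rounds and histories -/

/-- What the firm chooses in a round: the index `j` of a price level `j / K`, and the costs. -/
abbrev Choice (n K : ℕ) : Type := Fin (K + 1) × (Fin n → unitInterval)

/-- A completed round: the firm's choice and the observed demands. -/
abbrev Round (n K : ℕ) : Type := Choice n K × (Fin n → unitInterval)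

/-- Histories of `t` completed rounds. -/
def Hist (n K : ℕ) : ℕ → Type
  | 0 => Unit
  | t + 1 => Hist n K t × Round n K

instance instMeasurableSpaceHist (n K : ℕ) : (t : ℕ) → MeasurableSpace (Hist n K t)
  | 0 => inferInstanceAs (MeasurableSpace Unit)
  | t + 1 =>
    letI := instMeasurableSpaceHist n K t
    inferInstanceAs (MeasurableSpace (Hist n K t × Round n K))

/-- The price level `j / K`, for `j = 0, …, K`. -/
def priceLevel (K : ℕ) (j : Fin (K + 1)) : unitInterval :=
  ⟨(j : ℝ) / (K : ℝ), by positivity,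
    div_le_one_of_le₀ (by exact_mod_cast Nat.lt_succ_iff.mp j.isLt) (by positivity)⟩

/-- The realized profit of market `i` in a round. -/
def profit {n K : ℕ} (r : Round n K) (i : Fin n) : ℝ :=
  (priceLevel K r.1.1 : ℝ) * (r.2 i : ℝ) - (r.1.2 i : ℝ)

/-- The realized profit of the firm, summed over all markets and all rounds of a history. -/
def totalProfit {n K : ℕ} : (t : ℕ) → Hist n K t → ℝ
  | 0, _ => 0
  | t + 1, h => totalProfit t h.1 + ∑ i : Fin n, profit h.2 i

/-- The normalized observed loss of market `i` in a round. -/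
def loss {n K : ℕ} (r : Round n K) (i : Fin n) : ℝ := (1 - profit r i) / 2

/-! ## The algorithm -/

/-- The real parameters of the algorithm: learning rate `η`, bias parameter `γ`, and kernel
parameters `ε`, `δ`. -/
structure Params where
  η : ℝ
  γ : ℝ
  ε : ℝ
  δ : ℝ

/-- The mean of a density `u` on `[δ, 1 - δ]`. -/
def mean (δ : ℝ) (u : ℝ → ℝ) : ℝ := ∫ x in Set.Icc δ (1 - δ), x * u x

/-- The smoothing kernel `K_ε[u](x, y)`, as a function of the mean `μ` of `u`. -/
def smoothingKernel (δ ε μ x y : ℝ) : ℝ :=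
  if ε ≤ |y - μ| then (Set.Icc (min y μ) (max y μ)).indicator (fun _ => 1 / |y - μ|) x
  else if ε + δ ≤ μ then (Set.Icc (μ - ε) μ).indicator (fun _ => 1 / ε) x
  else (Set.Icc μ (μ + ε)).indicator (fun _ => 1 / ε) x

/-- The density `K_ε[u] u` on `[δ, 1 - δ]`, obtained by applying to `u` the linear operator that is
induced by the kernel `K_ε[u]`. -/
def smoothed (δ ε : ℝ) (u : ℝ → ℝ) (x : ℝ) : ℝ :=
  ∫ y in Set.Icc δ (1 - δ), smoothingKernel δ ε (mean δ u) x y * u y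

/-- The quantities maintained by the algorithm: the price distribution `q_{t,0}` on the price
levels, and the densities `u_{t,i}(· | p)` on `[δ, 1 - δ]` for each market and price level. -/
structure State (n K : ℕ) where
  price : Fin (K + 1) → ℝ
  dens : Fin n → Fin (K + 1) → ℝ → ℝ

/-- The initial state: uniform distributions. -/
def State.init (P : Params) (n K : ℕ) : State n K where
  price := fun _ => 1 / ((K : ℝ) + 1)
  dens := fun _ _ => (Set.Icc P.δ (1 - P.δ)).indicator (fun _ => 1 / (1 - 2 * P.δ))

/-- The density `q_{t,i}(· | p)` from which the cost of market `i` is drawn at price level `p`. -/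
def State.costDens {n K : ℕ} (P : Params) (s : State n K) (i : Fin n) (p : Fin (K + 1)) : ℝ → ℝ :=
  smoothed P.δ P.ε (s.dens i p)

/-- The loss estimator for the cost densities. -/
def State.fHat {n K : ℕ} (P : Params) (s : State n K) (r : Round n K) (i : Fin n) (c : ℝ)
    (p : Fin (K + 1)) : ℝ :=
  (loss r i * (if r.1.1 = p then 1 else 0)) /
      (s.costDens P i r.1.1 (r.1.2 i) * (s.price r.1.1 + P.γ)) *
    smoothingKernel P.δ P.ε (mean P.δ (s.dens i p)) (r.1.2 i) c

/-- The loss estimator for the price distribution. -/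
def State.hHat {n K : ℕ} (P : Params) (s : State n K) (r : Round n K) (p : Fin (K + 1)) : ℝ :=
  1 / (n : ℝ) *
      (((∑ i : Fin n, loss r i) * (if r.1.1 = p then 1 else 0)) / (s.price r.1.1 + P.γ)) +
    3 * P.η * Real.log (Real.exp 1 / P.ε) * (1 / P.γ - 1 / (s.price p + P.γ))

/-- The exponential weights updates at the end of a round. -/
def State.update {n K : ℕ} (P : Params) (s : State n K) (r : Round n K) : State n K where
  price := fun p =>
    s.price p * Real.exp (-P.η * s.hHat P r p) /
      ∑ p' : Fin (K + 1), s.price p' * Real.exp (-P.η * s.hHat P r p')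
  dens := fun i p c =>
    s.dens i p c * Real.exp (-P.η * s.fHat P r i c p) /
      ∫ c' in Set.Icc P.δ (1 - P.δ), s.dens i p c' * Real.exp (-P.η * s.fHat P r i c' p)

/-- The state of the algorithm after a history of `t` rounds. -/
def stateAt (P : Params) {n K : ℕ} : (t : ℕ) → Hist n K t → State n K
  | 0, _ => State.init P n K
  | t + 1, h => (stateAt P t h.1).update P h.2

/-- The joint density of the price level and the costs chosen in state `s`: the price level `p` has
distribution `q_{t,0}`, and given `p` the costs are independent with densities `q_{t,i}(· | p)`. -/
def State.choiceDens {n K : ℕ} (P : Params) (s : State n K) (a : Choice n K) : ℝ :=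
  s.price a.1 * ∏ i : Fin n, s.costDens P i a.1 (a.2 i)

/-- The law of the algorithm's choice in round `t` given the history, as a density with respect
to the product of counting measure on price levels and Lebesgue measure on costs. The density is
jointly measurable in the history and the choice. When `0 ≤ δ`, `0 < ε`, `δ + 2 ε ≤ 1 - δ`, all cost
densities vanish outside `[δ, 1 - δ]` and integrate to `1`, so that this is a Markov kernel. -/
def policy (P : Params) (n K t : ℕ) : Kernel (Hist n K t) (Choice n K) :=
  (Kernel.const (Hist n K t)
      ((Measure.count : Measure (Fin (K + 1))).prod
        (volume : Measure (Fin n → unitInterval)))).withDensity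
    (fun h a => ENNReal.ofReal ((stateAt P t h).choiceDens P a))

/-! ## The interaction and the regret -/

/-- The law of the demands of round `t` given the history and the choice of round `t`. -/
def Environment.response {n : ℕ} (E : Environment n) (K t : ℕ) :
    Kernel (Hist n K t × Choice n K) (Fin n → unitInterval) :=
  (E.demand t).comap (fun x => (x.2.2, priceLevel K x.2.1))
    ((measurable_snd.comp measurable_snd).prodMk
      ((measurable_of_finite (priceLevel K)).comp (measurable_fst.comp measurable_snd)))

/-- The law of the history of the first `t` rounds when the algorithm plays against `E`. -/
def law (P : Params) {n : ℕ} (E : Environment n) (K : ℕ) : (t : ℕ) → Measure (Hist n K t)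
  | 0 => Measure.dirac (α := Unit) ()
  | t + 1 =>
    (law P E K t).compProd ((policy P n K t).compProd (E.response K t))

/-- The expected regret of the algorithm after `T` rounds. -/
def regret (P : Params) {n : ℕ} (E : Environment n) (K T : ℕ) : ℝ :=
  E.opt T - ∫ h, totalProfit T h ∂(law P E K T)

/-- The parameters `ε = T⁻²`, `γ = η log (e / ε)`, `δ = T⁻¹`. -/
def tunedParams (η : ℝ) (T : ℕ) : Params where
  η := η
  γ := η * Real.log (Real.exp 1 / (1 / (T : ℝ) ^ 2))
  ε := 1 / (T : ℝ) ^ 2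
  δ := 1 / (T : ℝ)

end

end TargetedMarketing

namespace TargetedMarketing

/-! ## The smoothing kernel -/

/-! In terms of the normalized losses `(1 - profit) / 2`, whose means are convex in the cost, the
algorithm runs exponential weights over price levels and, for each market and level, exponential
weights over costs with a kernel-smoothed sampling density `q`. The proof follows the potential `log
q_{t,0}(p) + (2 / n) ∑ i, log u_{t,i}(c i | p)` of a fixed comparator `(p, c)`.

Bias of the cost estimators: the kernel sends a point `y` to the uniform law on the interval between
`y` and the mean `μ` of `u`. For a convex loss `l`, Hermite–Hadamard bounds the average of `l` there
by `(l y + l μ) / 2`, and Jensen bounds `l μ` by the loss `Λ = ∫ q l` of the sampling density, both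
up to `O(ε / δ)` (`setIntegral_kernel_mul_le`). The estimators thus see only half of `l c - Λ`; this
is the origin of the factor `2` in the potential. Variance: the kernel is at most `1 / max |x - μ|
ε` whatever `y` is, and this envelope has an integral of order `log (e / ε)` instead of `1 / ε`
(`smoothingKernel_le`, `integral_inv_max_le`).

Coupling of the two levels: at a rarely played price `p` the cost learners have variance terms of
size `2 γ / (q_{t,0}(p) + γ)`. The second summand of `hHat` equals `3 q_{t,0}(p) / (q_{t,0}(p) +
γ)`. It penalizes rare levels less than frequent ones and so raises the log-weight of `p` by enough
to pay for these terms, while the normalization loses only `3 γ (K + 1)` (`State.log_price_add_le`).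
The terms `Λ` of the two levels cancel, and the conditional expected gain of a round is at least
minus the mean loss of the comparator, up to `O(γ K + η K + ε / δ)` (`le_integral_market`,
`le_integral_roundGain`).

Summing over rounds, the potential starts at `-log (K + 1)` or higher. At the end `log q_{T,0}(p) ≤
0`, but the densities have no useful pointwise bound. Each `c i` is therefore taken in a prescribed
interval of length `δ`, at a point where the expected final density is at most `1 / δ`; the expected
logarithm is then at most `log (1 / δ)` (`exists_lintegral_dens_le`, `exists_costs_loss_le`).
Finally an arbitrary benchmark is moved into reach: shrinking the costs towards the interior changes
a convex loss by at most `3 δ`, and rounding the price down changes it by at most `1 / (2 K)`,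
because demand does not increase with the price (`regret_le`). -/

lemma smoothingKernel_nonneg {δ ε : ℝ} (hε : 0 < ε) (μ x y : ℝ) :
    0 ≤ smoothingKernel δ ε μ x y := by
  unfold smoothingKernel
  split_ifs <;> exact Set.indicator_nonneg (fun _ _ => by positivity) _

lemma measurable_smoothingKernel (δ ε : ℝ) :
    Measurable fun p : ℝ × ℝ × ℝ => smoothingKernel δ ε p.1 p.2.1 p.2.2 := by
  have hμ : Measurable fun p : ℝ × ℝ × ℝ => p.1 := measurable_fst
  have hx : Measurable fun p : ℝ × ℝ × ℝ => p.2.1 := by fun_prop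
  have hy : Measurable fun p : ℝ × ℝ × ℝ => p.2.2 := by fun_prop
  have hd : Measurable fun p : ℝ × ℝ × ℝ => |p.2.2 - p.1| := (hy.sub hμ).abs
  simp only [smoothingKernel, Set.indicator_apply, Set.mem_Icc]
  refine Measurable.ite (measurableSet_le measurable_const hd) ?_ ?_
  · refine Measurable.ite ?_ (measurable_const.div hd) measurable_const
    exact (measurableSet_le (hy.min hμ) hx).inter (measurableSet_le hx (hy.max hμ))
  · refine Measurable.ite (measurableSet_le measurable_const hμ) ?_ ?_
    · refine Measurable.ite ?_ measurable_const measurable_const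
      exact (measurableSet_le (hμ.sub_const ε) hx).inter (measurableSet_le hx hμ)
    · refine Measurable.ite ?_ measurable_const measurable_const
      exact (measurableSet_le hμ hx).inter (measurableSet_le hx (hμ.add_const ε))

/-- As a function of its first argument, the smoothing kernel is the uniform density on an
interval: either the interval between `y` and `μ`, or an interval of length `ε` close to both. -/
lemma exists_smoothingKernel_eq {δ ε μ y : ℝ} (hε : 0 < ε) (hδε : δ + 2 * ε ≤ 1 - δ)
    (hμ : μ ∈ Set.Icc δ (1 - δ)) (hy : y ∈ Set.Icc δ (1 - δ)) :
    ∃ a b : ℝ, a < b ∧ δ ≤ a ∧ b ≤ 1 - δ ∧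
      (∀ x, smoothingKernel δ ε μ x y = (Set.Icc a b).indicator (fun _ => 1 / (b - a)) x) ∧
      ((a = min y μ ∧ b = max y μ ∧ ε ≤ b - a) ∨
        (|y - μ| < ε ∧ b - a = ε ∧ ∀ x ∈ Set.Icc a b, |x - μ| ≤ ε)) := by
  obtain ⟨hμ1, hμ2⟩ := hμ
  obtain ⟨hy1, hy2⟩ := hy
  by_cases h : ε ≤ |y - μ|
  · have hab : max y μ - min y μ = |y - μ| := max_sub_min_eq_abs' y μ
    refine ⟨min y μ, max y μ, by linarith, le_min hy1 hμ1, max_le hy2 hμ2, fun x => ?_,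
      Or.inl ⟨rfl, rfl, by linarith⟩⟩
    rw [smoothingKernel, if_pos h, hab]
  · by_cases h' : ε + δ ≤ μ
    · refine ⟨μ - ε, μ, by linarith, by linarith, hμ2, fun x => ?_,
        Or.inr ⟨not_le.mp h, by ring, fun x hx => abs_le.mpr ⟨by linarith [hx.1], by linarith [hx.2]⟩⟩⟩
      rw [smoothingKernel, if_neg h, if_pos h', show μ - (μ - ε) = ε by ring]
    -- Here `μ < ε + δ`, so the right end is below `δ + 2 ε ≤ 1 - δ`.
    · refine ⟨μ, μ + ε, by linarith, hμ1, by linarith, fun x => ?_,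
        Or.inr ⟨not_le.mp h, by ring, fun x hx => abs_le.mpr ⟨by linarith [hx.1], by linarith [hx.2]⟩⟩⟩
      rw [smoothingKernel, if_neg h, if_neg h', show μ + ε - μ = ε by ring]

/-- A point `x` between `y` and `μ` satisfies `|x - μ| ≤ |y - μ|`, so the height `1 / |y - μ|` is at
most `1 / |x - μ|`. The envelope does not depend on `y`, which makes the variance logarithmic in
`ε`. -/
lemma smoothingKernel_le {δ ε : ℝ} (hε : 0 < ε) (μ x y : ℝ) :
    smoothingKernel δ ε μ x y ≤ 1 / max |x - μ| ε := by
  have h0 : 0 ≤ 1 / max |x - μ| ε := by positivity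
  have hm : 0 < max |x - μ| ε := lt_max_of_lt_right hε
  unfold smoothingKernel
  split_ifs with h1 h2
  · refine Set.indicator_apply_le' (fun hx => ?_) (fun _ => h0)
    refine one_div_le_one_div_of_le hm (max_le ?_ h1)
    rcases le_total y μ with h | h
    · rw [min_eq_left h, max_eq_right h] at hx
      rw [abs_of_nonpos (by linarith [hx.2]), abs_of_nonpos (by linarith)]
      linarith [hx.1]
    · rw [min_eq_right h, max_eq_left h] at hx
      rw [abs_of_nonneg (by linarith [hx.1]), abs_of_nonneg (by linarith)]
      linarith [hx.2]
  · refine Set.indicator_apply_le' (fun hx => ?_) (fun _ => h0)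
    exact one_div_le_one_div_of_le hm
      (max_le (abs_le.mpr ⟨by linarith [hx.1], by linarith [hx.2]⟩) le_rfl)
  · refine Set.indicator_apply_le' (fun hx => ?_) (fun _ => h0)
    exact one_div_le_one_div_of_le hm
      (max_le (abs_le.mpr ⟨by linarith [hx.1], by linarith [hx.2]⟩) le_rfl)

lemma smoothingKernel_le_inv {δ ε : ℝ} (hε : 0 < ε) (μ x y : ℝ) :
    smoothingKernel δ ε μ x y ≤ 1 / ε :=
  (smoothingKernel_le hε μ x y).trans (one_div_le_one_div_of_le hε (le_max_right _ _))

/-- Integrating against the uniform density on a subinterval of `[0, 1]`. -/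
lemma setIntegral_uniform_mul {a b : ℝ} (hab : a < b) (ha : 0 ≤ a) (hb : b ≤ 1) (g : ℝ → ℝ) :
    ∫ x in Set.Icc (0 : ℝ) 1, (Set.Icc a b).indicator (fun _ => 1 / (b - a)) x * g x =
      1 / (b - a) * ∫ x in a..b, g x := by
  have h : (fun x => (Set.Icc a b).indicator (fun _ => 1 / (b - a)) x * g x) =
      (Set.Icc a b).indicator (fun x => 1 / (b - a) * g x) := by
    ext x
    by_cases hx : x ∈ Set.Icc a b <;> simp [hx]
  rw [h, setIntegral_indicator measurableSet_Icc,
    Set.inter_eq_right.mpr (Set.Icc_subset_Icc ha hb), integral_const_mul,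
    intervalIntegral.integral_of_le hab.le, integral_Icc_eq_integral_Ioc]

lemma integrableOn_Icc_of_bounded {g : ℝ → ℝ} (hg : Measurable g) {C a b : ℝ}
    (hC : ∀ x ∈ Set.Icc a b, |g x| ≤ C) : IntegrableOn g (Set.Icc a b) := by
  refine Measure.integrableOn_of_bounded (M := C) (by simp) hg.aestronglyMeasurable ?_
  exact (ae_restrict_iff' measurableSet_Icc).mpr (Filter.Eventually.of_forall hC)

lemma setIntegral_smoothingKernel {δ ε μ y : ℝ} (hδ : 0 ≤ δ) (hε : 0 < ε)
    (hδε : δ + 2 * ε ≤ 1 - δ) (hμ : μ ∈ Set.Icc δ (1 - δ)) (hy : y ∈ Set.Icc δ (1 - δ)) :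
    ∫ x in Set.Icc (0 : ℝ) 1, smoothingKernel δ ε μ x y = 1 := by
  obtain ⟨a, b, hab, ha, hb, hK, -⟩ := exists_smoothingKernel_eq hε hδε hμ hy
  have := setIntegral_uniform_mul hab (by linarith) (by linarith) (fun _ => (1 : ℝ))
  simp only [mul_one] at this
  simp_rw [hK, this]
  simp only [intervalIntegral.integral_const, smul_eq_mul, mul_one]
  field_simp [sub_ne_zero.mpr hab.ne']

/-! ## Convex functions on the unit interval -/

/-- The supremum of the left difference quotients at `m` serves as slope: by monotonicity of slopes
it is bounded by every right difference quotient. -/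
lemma exists_subgradient {l : ℝ → ℝ} (hl : ConvexOn ℝ (Set.Icc 0 1) l) {m : ℝ} (h0 : 0 < m)
    (h1 : m < 1) : ∃ g : ℝ, ∀ x ∈ Set.Icc (0 : ℝ) 1, l m + g * (x - m) ≤ l x := by
  set S : Set ℝ := (fun x => (l m - l x) / (m - x)) '' Set.Ico 0 m
  have hmem : m ∈ Set.Icc (0 : ℝ) 1 := ⟨h0.le, h1.le⟩
  have hub : ∀ z ∈ Set.Ioc m 1, ∀ s ∈ S, s ≤ (l z - l m) / (z - m) := by
    rintro z hz _ ⟨x, hx, rfl⟩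
    exact hl.slope_mono_adjacent ⟨hx.1, by linarith [hx.2]⟩ ⟨by linarith [hz.1], hz.2⟩ hx.2 hz.1
  have hne : S.Nonempty := ⟨_, 0, ⟨le_rfl, h0⟩, rfl⟩
  have hbdd : BddAbove S := ⟨_, fun s hs => hub 1 ⟨h1, le_rfl⟩ s hs⟩
  refine ⟨sSup S, fun x hx => ?_⟩
  rcases lt_trichotomy x m with h | rfl | h
  · have := le_csSup hbdd ⟨x, ⟨hx.1, h⟩, rfl⟩
    simp only at this
    rw [div_le_iff₀ (by linarith)] at this
    linarith
  · simp
  · have := csSup_le hne (hub x ⟨h, hx.2⟩)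
    rw [le_div_iff₀ (by linarith)] at this
    linarith

/-- The supporting line stays below `l ≤ 1` at both `0` and `1`, starts from `l m ≥ 0`, and `m` has
distance at least `δ` from either end. -/
lemma abs_subgradient_le {l : ℝ → ℝ} (hb : ∀ x ∈ Set.Icc (0 : ℝ) 1, l x ∈ Set.Icc (0 : ℝ) 1)
    {δ m g : ℝ} (hδ : 0 < δ) (hm : m ∈ Set.Icc δ (1 - δ))
    (hg : ∀ x ∈ Set.Icc (0 : ℝ) 1, l m + g * (x - m) ≤ l x) : |g| ≤ 1 / δ := by
  have e0 := hg 0 ⟨le_rfl, zero_le_one⟩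
  have e1 := hg 1 ⟨zero_le_one, le_rfl⟩
  have b0 := hb 0 ⟨le_rfl, zero_le_one⟩
  have b1 := hb 1 ⟨zero_le_one, le_rfl⟩
  have bm := hb m ⟨by linarith [hm.1], by linarith [hm.2]⟩
  obtain ⟨hm1, hm2⟩ := hm
  rw [le_div_iff₀ hδ]
  rcases abs_cases g with ⟨h, h'⟩ | ⟨h, h'⟩ <;> rw [h] <;> nlinarith [b0.1, b0.2, b1.1, b1.2, bm.1, bm.2]

/-- Away from the endpoints a bounded convex function is `1 / δ`-Lipschitz. This is what controls
the kernel in its degenerate case `|y - μ| < ε`. -/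
lemma convex_sub_le {l : ℝ → ℝ} (hl : ConvexOn ℝ (Set.Icc 0 1) l)
    (hb : ∀ x ∈ Set.Icc (0 : ℝ) 1, l x ∈ Set.Icc (0 : ℝ) 1) {δ x y : ℝ} (hδ : 0 < δ)
    (hx : x ∈ Set.Icc δ (1 - δ)) (hy : y ∈ Set.Icc δ (1 - δ)) :
    l x - l y ≤ |x - y| / δ := by
  obtain ⟨g, hg⟩ := exists_subgradient hl (m := x) (by linarith [hx.1]) (by linarith [hx.2])
  have h1 := abs_subgradient_le hb hδ hx hg
  have h2 := hg y ⟨by linarith [hy.1], by linarith [hy.2]⟩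
  have h3 : g * (x - y) ≤ |g| * |x - y| := (le_abs_self _).trans (abs_mul _ _).le
  have h4 : |g| * |x - y| ≤ 1 / δ * |x - y| := by gcongr
  have h5 : 1 / δ * |x - y| = |x - y| / δ := by ring
  linarith

/-- The right half of the Hermite–Hadamard inequality. -/
lemma integral_le_of_convexOn {l : ℝ → ℝ} {a b : ℝ} (hab : a < b)
    (hl : ConvexOn ℝ (Set.Icc a b) l) (hi : IntervalIntegrable l volume a b) :
    ∫ x in a..b, l x ≤ (b - a) * ((l a + l b) / 2) := by
  have hchord : ∀ x ∈ Set.Icc a b, l x ≤ l a + (l b - l a) / (b - a) * (x - a) := by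
    intro x hx
    have hba : 0 < b - a := by linarith
    have := hl.2 (Set.left_mem_Icc.mpr hab.le) (Set.right_mem_Icc.mpr hab.le)
      (div_nonneg (by linarith [hx.2]) hba.le) (div_nonneg (by linarith [hx.1]) hba.le)
      (show (b - x) / (b - a) + (x - a) / (b - a) = 1 by field_simp; ring)
    have e : ((b - x) / (b - a)) • a + ((x - a) / (b - a)) • b = x := by
      simp only [smul_eq_mul]; field_simp; ring
    rw [e] at this
    refine this.trans (le_of_eq ?_)
    simp only [smul_eq_mul]; field_simp; ring
  refine (intervalIntegral.integral_mono_on hab.le hi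
    (Continuous.intervalIntegrable (by fun_prop) _ _) hchord).trans (le_of_eq ?_)
  rw [intervalIntegral.integral_add (by simp) (Continuous.intervalIntegrable (by fun_prop) _ _),
    intervalIntegral.integral_const_mul, intervalIntegral.integral_sub (by simp) (by simp)]
  simp only [intervalIntegral.integral_const, integral_id, smul_eq_mul]
  field_simp [sub_ne_zero.mpr hab.ne']
  ring

section Averages

variable {l : ℝ → ℝ} {δ ε μ y : ℝ}

/-- If the interval joins `y` and `μ`, this is Hermite–Hadamard without error. Otherwise its points
are within `2 ε` of `y` and `ε` of `μ`, and averaging the two Lipschitz errors gives `3 / 2 * (ε /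
δ)`. -/
lemma setIntegral_smoothingKernel_mul_le (hl : ConvexOn ℝ (Set.Icc 0 1) l)
    (hlm : Measurable l) (hb : ∀ x ∈ Set.Icc (0 : ℝ) 1, l x ∈ Set.Icc (0 : ℝ) 1) (hδ : 0 < δ)
    (hε : 0 < ε) (hδε : δ + 2 * ε ≤ 1 - δ) (hμ : μ ∈ Set.Icc δ (1 - δ))
    (hy : y ∈ Set.Icc δ (1 - δ)) :
    ∫ x in Set.Icc (0 : ℝ) 1, smoothingKernel δ ε μ x y * l x ≤
      (l y + l μ) / 2 + 3 / 2 * (ε / δ) := by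
  obtain ⟨a, b, hab, ha, hb1, hK, hcase⟩ := exists_smoothingKernel_eq hε hδε hμ hy
  have hsub : Set.Icc a b ⊆ Set.Icc 0 1 := Set.Icc_subset_Icc (by linarith) (by linarith)
  have hsub' : Set.Icc a b ⊆ Set.Icc δ (1 - δ) := Set.Icc_subset_Icc ha hb1
  have hint : IntervalIntegrable l volume a b := by
    rw [intervalIntegrable_iff_integrableOn_Icc_of_le hab.le]
    exact integrableOn_Icc_of_bounded hlm (C := 1) fun x hx => by
      rw [abs_of_nonneg (hb x (hsub hx)).1]; exact (hb x (hsub hx)).2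
  simp_rw [hK]
  rw [setIntegral_uniform_mul hab (by linarith) (by linarith)]
  have hpos : 0 < b - a := by linarith
  have hεδ : 0 ≤ ε / δ := by positivity
  rcases hcase with ⟨rfl, rfl, -⟩ | ⟨hyμ, hlen, hclose⟩
  · have h := integral_le_of_convexOn hab (hl.subset hsub (convex_Icc _ _)) hint
    have hs : l (min y μ) + l (max y μ) = l y + l μ := by
      rcases le_total y μ with h | h <;> simp [h, add_comm]
    rw [hs] at h
    rw [one_div, inv_mul_le_iff₀ hpos]
    nlinarith
  · have hbound : ∀ x ∈ Set.Icc a b, l x ≤ (l y + l μ) / 2 + 3 / 2 * (ε / δ) := by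
      intro x hx
      have h1 := convex_sub_le hl hb hδ (hsub' hx) hy
      have h2 := convex_sub_le hl hb hδ (hsub' hx) hμ
      have h3 := hclose x hx
      have h4 : |x - y| ≤ 2 * ε := by
        have := abs_sub_le x μ y
        rw [abs_sub_comm μ y] at this
        linarith
      have h5 : |x - y| / δ ≤ 2 * (ε / δ) := by
        rw [← mul_div_assoc]; gcongr
      have h6 : |x - μ| / δ ≤ ε / δ := by gcongr
      linarith
    have h := intervalIntegral.integral_mono_on hab.le hint (by simp) hbound
    rw [intervalIntegral.integral_const, smul_eq_mul] at h
    rwa [one_div, inv_mul_le_iff₀ hpos]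

/-- The interval from `y` to `μ` has its midpoint at distance `(y - μ) / 2` from `μ`, so the
supporting line at `μ` averages to the left side. The bound is affine in `y` on purpose: its slope
term disappears when averaged over `u`. In the degenerate case the displacement is off by at most `3
/ 2 * ε`, and the slope is at most `1 / δ`. -/
lemma le_setIntegral_smoothingKernel_mul
    (hlm : Measurable l) (hb : ∀ x ∈ Set.Icc (0 : ℝ) 1, l x ∈ Set.Icc (0 : ℝ) 1) (hδ : 0 < δ)
    (hε : 0 < ε) (hδε : δ + 2 * ε ≤ 1 - δ) (hμ : μ ∈ Set.Icc δ (1 - δ))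
    (hy : y ∈ Set.Icc δ (1 - δ)) {g : ℝ}
    (hg : ∀ x ∈ Set.Icc (0 : ℝ) 1, l μ + g * (x - μ) ≤ l x) :
    l μ + g * ((y - μ) / 2) - 3 / 2 * (ε / δ) ≤
      ∫ x in Set.Icc (0 : ℝ) 1, smoothingKernel δ ε μ x y * l x := by
  obtain ⟨a, b, hab, ha, hb1, hK, hcase⟩ := exists_smoothingKernel_eq hε hδε hμ hy
  have hsub : Set.Icc a b ⊆ Set.Icc 0 1 := Set.Icc_subset_Icc (by linarith) (by linarith)
  have hint : IntervalIntegrable l volume a b := by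
    rw [intervalIntegrable_iff_integrableOn_Icc_of_le hab.le]
    exact integrableOn_Icc_of_bounded hlm (C := 1) fun x hx => by
      rw [abs_of_nonneg (hb x (hsub hx)).1]; exact (hb x (hsub hx)).2
  simp_rw [hK]
  rw [setIntegral_uniform_mul hab (by linarith) (by linarith)]
  have hpos : 0 < b - a := by linarith
  have hεδ : 0 ≤ ε / δ := by positivity
  have hgδ := abs_subgradient_le hb hδ hμ hg
  rw [one_div, le_inv_mul_iff₀ hpos]
  rcases hcase with ⟨rfl, rfl, -⟩ | ⟨hyμ, hlen, hclose⟩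
  · set a := min y μ
    set b := max y μ
    have h := intervalIntegral.integral_mono_on hab.le
      (Continuous.intervalIntegrable (u := fun x => l μ + g * (x - μ)) (by fun_prop) _ _) hint
      (fun x hx => hg x (hsub hx))
    rw [intervalIntegral.integral_add (by simp) (Continuous.intervalIntegrable (by fun_prop) _ _),
      intervalIntegral.integral_const_mul, intervalIntegral.integral_sub (by simp) (by simp)] at h
    simp only [intervalIntegral.integral_const, integral_id, smul_eq_mul] at h
    have hs : a + b = y + μ := min_add_max y μ
    have e : (b - a) * l μ + g * ((b ^ 2 - a ^ 2) / 2 - (b - a) * μ) =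
        (b - a) * (l μ + g * ((y - μ) / 2)) := by
      have : y = a + b - μ := by linarith
      rw [this]; ring
    nlinarith
  · have hbound : ∀ x ∈ Set.Icc a b, l μ + g * ((y - μ) / 2) - 3 / 2 * (ε / δ) ≤ l x := by
      intro x hx
      have h1 := hg x (hsub hx)
      have h3 := hclose x hx
      have h4 : g * ((y - μ) / 2 - (x - μ)) ≤ 1 / δ * (3 / 2 * ε) := by
        refine (le_abs_self _).trans ?_
        rw [abs_mul]
        refine mul_le_mul hgδ ?_ (abs_nonneg _) (by positivity)
        rw [abs_le] at *
        rw [abs_lt] at hyμ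
        constructor <;> linarith
      have h5 : 1 / δ * (3 / 2 * ε) = 3 / 2 * (ε / δ) := by ring
      linarith
    have h := intervalIntegral.integral_mono_on hab.le (by simp) hint hbound
    rwa [intervalIntegral.integral_const, smul_eq_mul] at h

end Averages

/-- The envelope of the kernel has a logarithmic integral. -/
lemma integral_inv_max_le {ε μ : ℝ} (hε : 0 < ε) (hε1 : ε ≤ 1) (hμ : μ ∈ Set.Icc (0 : ℝ) 1) :
    ∫ x in Set.Icc (0 : ℝ) 1, 1 / max |x - μ| ε ≤ 2 * Real.log (Real.exp 1 / ε) := by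
  have hcont : Continuous fun z : ℝ => 1 / max |z| ε :=
    continuous_const.div (by fun_prop) fun z => (lt_max_of_lt_right hε).ne'
  have hpos : ∀ z : ℝ, 0 ≤ 1 / max |z| ε := fun z => by positivity
  -- The flat part `[0, ε]` contributes `1` and the part `[ε, 1]` contributes `log (1 / ε)`.
  have hone : ∫ z in (0 : ℝ)..1, 1 / max |z| ε = Real.log (Real.exp 1 / ε) := by
    rw [← intervalIntegral.integral_add_adjacent_intervals (b := ε)
      (hcont.intervalIntegrable _ _) (hcont.intervalIntegrable _ _)]
    have e1 : ∫ z in (0 : ℝ)..ε, 1 / max |z| ε = ∫ z in (0 : ℝ)..ε, 1 / ε := by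
      refine intervalIntegral.integral_congr fun z hz => ?_
      rw [Set.uIcc_of_le hε.le] at hz
      rw [abs_of_nonneg hz.1, max_eq_right hz.2]
    have e2 : ∫ z in ε..1, 1 / max |z| ε = ∫ z in ε..1, 1 / z := by
      refine intervalIntegral.integral_congr fun z hz => ?_
      rw [Set.uIcc_of_le hε1] at hz
      rw [abs_of_nonneg (hε.le.trans hz.1), max_eq_left hz.1]
    rw [e1, e2, integral_one_div_of_pos hε one_pos, intervalIntegral.integral_const, smul_eq_mul,
      Real.log_div (Real.exp_ne_zero _) hε.ne', Real.log_exp, Real.log_div one_ne_zero hε.ne',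
      Real.log_one]
    field_simp
    ring
  have hneg : ∫ z in (-1 : ℝ)..0, 1 / max |z| ε = Real.log (Real.exp 1 / ε) := by
    rw [← hone]
    have := intervalIntegral.integral_comp_neg (a := (0 : ℝ)) (b := 1)
      (fun z : ℝ => 1 / max |z| ε)
    simp only [abs_neg, neg_zero] at this
    exact this.symm
  rw [integral_Icc_eq_integral_Ioc, ← intervalIntegral.integral_of_le zero_le_one]
  -- After translation by `μ` the domain `[-μ, 1 - μ]` lies in `[-1, 1]`, whose two halves
  -- contribute equally.
  have hsh := intervalIntegral.integral_comp_sub_right (a := 0) (b := 1)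
    (fun z : ℝ => 1 / max |z| ε) μ
  rw [hsh, two_mul]
  nth_rewrite 1 [← hneg]
  rw [← hone, intervalIntegral.integral_add_adjacent_intervals
      (hcont.intervalIntegrable _ _) (hcont.intervalIntegrable _ _)]
  exact intervalIntegral.integral_mono_interval (by linarith [hμ.2]) (by linarith)
    (by linarith [hμ.1]) (Filter.Eventually.of_forall hpos) (hcont.intervalIntegrable _ _)

end TargetedMarketing

namespace TargetedMarketing

/-! ## Densities on `[δ, 1 - δ]` -/

/-- A positive probability density on `[δ, 1 - δ]`. -/
structure IsDensity (δ : ℝ) (u : ℝ → ℝ) : Prop where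
  measurable : Measurable u
  nonneg : ∀ x, 0 ≤ u x
  pos : ∀ x ∈ Set.Icc δ (1 - δ), 0 < u x
  integral_eq_one : ∫ x in Set.Icc δ (1 - δ), u x = 1

namespace IsDensity

variable {δ ε : ℝ} {u : ℝ → ℝ}

lemma integrableOn (hu : IsDensity δ u) : IntegrableOn u (Set.Icc δ (1 - δ)) := by
  by_contra h
  have := hu.integral_eq_one
  rw [integral_undef h] at this
  exact zero_ne_one this

lemma integrableOn_mul (hu : IsDensity δ u) {g : ℝ → ℝ} (hg : Measurable g) {C : ℝ}
    (hC : ∀ x ∈ Set.Icc δ (1 - δ), |g x| ≤ C) :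
    IntegrableOn (fun x => g x * u x) (Set.Icc δ (1 - δ)) :=
  hu.integrableOn.bdd_mul hg.aestronglyMeasurable
    ((ae_restrict_iff' measurableSet_Icc).mpr (Filter.Eventually.of_forall hC))

lemma mean_mem (hu : IsDensity δ u) (hδ : 0 ≤ δ) : mean δ u ∈ Set.Icc δ (1 - δ) := by
  have hi : IntegrableOn (fun x => x * u x) (Set.Icc δ (1 - δ)) :=
    hu.integrableOn_mul measurable_id (C := 1) fun x hx =>
      abs_le.mpr ⟨by linarith [hx.1], by linarith [hx.2]⟩
  have h1 : ∫ x in Set.Icc δ (1 - δ), δ * u x ≤ ∫ x in Set.Icc δ (1 - δ), x * u x :=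
    setIntegral_mono_on (hu.integrableOn.const_mul δ) hi measurableSet_Icc
      fun x hx => mul_le_mul_of_nonneg_right hx.1 (hu.nonneg x)
  have h2 : ∫ x in Set.Icc δ (1 - δ), x * u x ≤ ∫ x in Set.Icc δ (1 - δ), (1 - δ) * u x :=
    setIntegral_mono_on hi (hu.integrableOn.const_mul (1 - δ)) measurableSet_Icc
      fun x hx => mul_le_mul_of_nonneg_right hx.2 (hu.nonneg x)
  rw [integral_const_mul, hu.integral_eq_one, mul_one] at h1 h2
  exact ⟨h1, h2⟩

end IsDensity

lemma measurable_mean {α : Type*} [MeasurableSpace α] {u : α → ℝ → ℝ} {δ : ℝ}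
    (hu : Measurable fun z : α × ℝ => u z.1 z.2) : Measurable fun a => mean δ (u a) := by
  have : Measurable fun z : α × ℝ => z.2 * u z.1 z.2 := measurable_snd.mul hu
  exact (this.stronglyMeasurable.integral_prod_right'
    (ν := volume.restrict (Set.Icc δ (1 - δ)))).measurable

lemma measurable_smoothed {α : Type*} [MeasurableSpace α] {u : α → ℝ → ℝ} {δ ε : ℝ}
    (hu : Measurable fun z : α × ℝ => u z.1 z.2) :
    Measurable fun z : α × ℝ => smoothed δ ε (u z.1) z.2 := by
  have hm : Measurable fun z : (α × ℝ) × ℝ => (mean δ (u z.1.1), z.1.2, z.2) :=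
    ((measurable_mean hu).comp (measurable_fst.comp measurable_fst)).prodMk
      ((measurable_snd.comp measurable_fst).prodMk measurable_snd)
  have : Measurable fun z : (α × ℝ) × ℝ =>
      smoothingKernel δ ε (mean δ (u z.1.1)) z.1.2 z.2 * u z.1.1 z.2 :=
    ((measurable_smoothingKernel δ ε).comp hm).mul
      (hu.comp ((measurable_fst.comp measurable_fst).prodMk measurable_snd))
  exact (this.stronglyMeasurable.integral_prod_right'
    (ν := volume.restrict (Set.Icc δ (1 - δ)))).measurable

lemma measurable_smoothingKernel_left (δ ε μ y : ℝ) :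
    Measurable fun x => smoothingKernel δ ε μ x y :=
  (measurable_smoothingKernel δ ε).comp (by fun_prop : Measurable fun x : ℝ => (μ, x, y))

lemma measurable_smoothingKernel_right (δ ε μ x : ℝ) :
    Measurable fun y => smoothingKernel δ ε μ x y :=
  (measurable_smoothingKernel δ ε).comp (by fun_prop : Measurable fun y : ℝ => (μ, x, y))

namespace IsDensity

variable {δ ε : ℝ} {u : ℝ → ℝ}

lemma measurable_smoothed (hu : IsDensity δ u) : Measurable (smoothed δ ε u) :=
  (TargetedMarketing.measurable_smoothed (u := fun _ : Unit => u)
    (hu.measurable.comp measurable_snd)).comp (by fun_prop : Measurable fun x : ℝ => ((), x))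

lemma smoothed_nonneg (hu : IsDensity δ u) (hε : 0 < ε) (x : ℝ) : 0 ≤ smoothed δ ε u x :=
  integral_nonneg fun y => mul_nonneg (smoothingKernel_nonneg hε _ _ _) (hu.nonneg y)

lemma integrableOn_kernel_mul (hu : IsDensity δ u) (hε : 0 < ε) (x : ℝ) :
    IntegrableOn (fun y => smoothingKernel δ ε (mean δ u) x y * u y) (Set.Icc δ (1 - δ)) :=
  hu.integrableOn_mul (measurable_smoothingKernel_right _ _ _ _) (C := 1 / ε) fun y _ => by
    rw [abs_of_nonneg (smoothingKernel_nonneg hε _ _ _)]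
    exact smoothingKernel_le_inv hε _ _ _

lemma smoothed_le (hu : IsDensity δ u) (hε : 0 < ε) (x : ℝ) : smoothed δ ε u x ≤ 1 / ε := by
  have := setIntegral_mono_on (hu.integrableOn_kernel_mul hε x) (hu.integrableOn.const_mul (1 / ε))
    measurableSet_Icc fun y _ =>
      mul_le_mul_of_nonneg_right (smoothingKernel_le_inv hε _ _ _) (hu.nonneg y)
  rwa [integral_const_mul, hu.integral_eq_one, mul_one] at this

/-- One factor of the kernel is replaced by its `y`-free envelope and leaves the integral; the other
factor integrates to the smoothed density. -/
lemma integral_kernel_sq_mul_le (hu : IsDensity δ u) (hε : 0 < ε) (x : ℝ) :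
    ∫ y in Set.Icc δ (1 - δ), smoothingKernel δ ε (mean δ u) x y ^ 2 * u y ≤
      1 / max |x - mean δ u| ε * smoothed δ ε u x := by
  rw [smoothed, ← integral_const_mul]
  refine setIntegral_mono_on ?_ ((hu.integrableOn_kernel_mul hε x).const_mul _) measurableSet_Icc
    fun y _ => ?_
  · refine hu.integrableOn_mul ((measurable_smoothingKernel_right _ _ _ _).pow_const 2)
      (C := (1 / ε) ^ 2) fun y _ => ?_
    rw [abs_of_nonneg (sq_nonneg _)]
    exact pow_le_pow_left₀ (smoothingKernel_nonneg hε _ _ _) (smoothingKernel_le_inv hε _ _ _) 2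
  · rw [sq, mul_assoc]
    exact mul_le_mul_of_nonneg_right (smoothingKernel_le hε _ _ _)
      (mul_nonneg (smoothingKernel_nonneg hε _ _ _) (hu.nonneg y))

/-- Duality, by Fubini: smoothing the density amounts to averaging the test function with the
kernel. -/
lemma integral_smoothed_mul (hu : IsDensity δ u) (hε : 0 < ε) {g : ℝ → ℝ} (hg : Measurable g)
    {C : ℝ} (hC : ∀ x ∈ Set.Icc (0 : ℝ) 1, |g x| ≤ C) :
    ∫ x in Set.Icc (0 : ℝ) 1, smoothed δ ε u x * g x =
      ∫ y in Set.Icc δ (1 - δ),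
        (∫ x in Set.Icc (0 : ℝ) 1, smoothingKernel δ ε (mean δ u) x y * g x) * u y := by
  have hmeas : Measurable fun z : ℝ × ℝ =>
      smoothingKernel δ ε (mean δ u) z.1 z.2 * g z.1 :=
    ((measurable_smoothingKernel δ ε).comp
      (by fun_prop : Measurable fun z : ℝ × ℝ => (mean δ u, z.1, z.2))).mul
      (hg.comp measurable_fst)
  have hC0 : 0 ≤ C := (abs_nonneg _).trans (hC 0 ⟨le_rfl, zero_le_one⟩)
  have hint : Integrable (Function.uncurry fun x y =>
      (smoothingKernel δ ε (mean δ u) x y * g x) * u y)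
      ((volume.restrict (Set.Icc (0 : ℝ) 1)).prod (volume.restrict (Set.Icc δ (1 - δ)))) := by
    have h1 : Integrable (fun z : ℝ × ℝ => u z.2)
      ((volume.restrict (Set.Icc (0 : ℝ) 1)).prod (volume.restrict (Set.Icc δ (1 - δ)))) :=
      hu.integrableOn.comp_snd _
    refine h1.bdd_mul (c := 1 / ε * C) hmeas.aestronglyMeasurable ?_
    rw [Measure.prod_restrict]
    refine (ae_restrict_iff' 
      ((measurableSet_Icc (a := (0 : ℝ)) (b := 1)).prod
        (measurableSet_Icc (a := δ) (b := 1 - δ)))).mpr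
      (Filter.Eventually.of_forall fun z hz => ?_)
    rw [Real.norm_eq_abs, abs_mul, abs_of_nonneg (smoothingKernel_nonneg hε _ _ _)]
    exact mul_le_mul (smoothingKernel_le_inv hε _ _ _) (hC _ hz.1) (abs_nonneg _) (by positivity)
  have := integral_integral_swap hint
  simp only [integral_mul_const] at this
  rw [← this]
  refine integral_congr_ae (Filter.Eventually.of_forall fun x => ?_)
  simp only [smoothed]
  rw [← integral_mul_const]
  exact integral_congr_ae (Filter.Eventually.of_forall fun y => by ring)

lemma integral_smoothed (hu : IsDensity δ u) (hδ : 0 ≤ δ) (hε : 0 < ε)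
    (hδε : δ + 2 * ε ≤ 1 - δ) : ∫ x in Set.Icc (0 : ℝ) 1, smoothed δ ε u x = 1 := by
  have := hu.integral_smoothed_mul hε (g := fun _ => 1) measurable_const (C := 1) (by simp)
  simp only [mul_one] at this
  rw [this]
  refine Eq.trans ?_ hu.integral_eq_one
  refine setIntegral_congr_fun measurableSet_Icc fun y hy => ?_
  rw [setIntegral_smoothingKernel hδ hε hδε (hu.mean_mem hδ) hy, one_mul]

/-- Jensen's inequality for the smoothed density. -/
lemma apply_mean_le {l : ℝ → ℝ} (hl : ConvexOn ℝ (Set.Icc 0 1) l)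
    (hlm : Measurable l) (hb : ∀ x ∈ Set.Icc (0 : ℝ) 1, l x ∈ Set.Icc (0 : ℝ) 1)
    (hu : IsDensity δ u) (hδ : 0 < δ) (hε : 0 < ε) (hδε : δ + 2 * ε ≤ 1 - δ) :
    l (mean δ u) ≤ (∫ x in Set.Icc (0 : ℝ) 1, smoothed δ ε u x * l x) + 3 / 2 * (ε / δ) := by
  have hμ := hu.mean_mem hδ.le
  set μ := mean δ u with hμdef
  obtain ⟨g, hg⟩ := exists_subgradient hl (m := μ) (by linarith [hμ.1]) (by linarith [hμ.2])
  have habs : ∀ x ∈ Set.Icc (0 : ℝ) 1, |l x| ≤ 1 := fun x hx => by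
    rw [abs_of_nonneg (hb x hx).1]; exact (hb x hx).2
  rw [hu.integral_smoothed_mul hε hlm habs, ← hμdef]
  -- The slope term vanishes because `μ` is the mean of `u`.
  have hlow : ∫ y in Set.Icc δ (1 - δ), (l μ + g * ((y - μ) / 2) - 3 / 2 * (ε / δ)) * u y =
      l μ - 3 / 2 * (ε / δ) := by
    have hi : IntegrableOn (fun x => x * u x) (Set.Icc δ (1 - δ)) :=
      hu.integrableOn_mul measurable_id (C := 1) fun x hx =>
        abs_le.mpr ⟨by linarith [hx.1], by linarith [hx.2]⟩
    have e : ∀ y, (l μ + g * ((y - μ) / 2) - 3 / 2 * (ε / δ)) * u y =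
        (l μ - g * μ / 2 - 3 / 2 * (ε / δ)) * u y + g / 2 * (y * u y) := fun y => by ring
    simp_rw [e]
    rw [integral_add (hu.integrableOn.const_mul _) (hi.const_mul _), integral_const_mul,
      integral_const_mul, hu.integral_eq_one]
    have : ∫ y in Set.Icc δ (1 - δ), y * u y = μ := rfl
    rw [this]; ring
  have hKm : Measurable fun y =>
      ∫ x in Set.Icc (0 : ℝ) 1, smoothingKernel δ ε μ x y * l x := by
    have : Measurable fun z : ℝ × ℝ => smoothingKernel δ ε μ z.2 z.1 * l z.2 :=
      ((measurable_smoothingKernel δ ε).comp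
        (by fun_prop : Measurable fun z : ℝ × ℝ => (μ, z.2, z.1))).mul (hlm.comp measurable_snd)
    exact (this.stronglyMeasurable.integral_prod_right'
      (ν := volume.restrict (Set.Icc (0 : ℝ) 1))).measurable
  have hgδ := abs_subgradient_le hb hδ hμ hg
  have := setIntegral_mono_on (μ := volume) (s := Set.Icc δ (1 - δ))
    (f := fun y => (l μ + g * ((y - μ) / 2) - 3 / 2 * (ε / δ)) * u y)
    (g := fun y => (∫ x in Set.Icc (0 : ℝ) 1, smoothingKernel δ ε μ x y * l x) * u y)
    ?_ ?_ measurableSet_Icc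
    (fun y hy => mul_le_mul_of_nonneg_right
      (le_setIntegral_smoothingKernel_mul hlm hb hδ hε hδε hμ hy hg) (hu.nonneg y))
  · rw [hlow] at this
    linarith
  · by_contra h
    rw [integral_undef h] at hlow
    refine h (hu.integrableOn_mul (by fun_prop) (C := |l μ| + |g| * 1 + 3 / 2 * (ε / δ))
      fun y hy => ?_)
    refine (abs_sub _ _).trans (add_le_add ((abs_add_le _ _).trans (add_le_add le_rfl ?_)) ?_)
    · rw [abs_mul]
      refine mul_le_mul_of_nonneg_left ?_ (abs_nonneg _)
      exact abs_le.mpr ⟨by linarith [hy.1, hμ.2], by linarith [hy.2, hμ.1]⟩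
    · rw [abs_of_nonneg (by positivity)]
  · refine hu.integrableOn_mul hKm (C := 1) fun y hy => ?_
    rw [abs_le]
    have hle : ∀ x ∈ Set.Icc (0 : ℝ) 1, 0 ≤ smoothingKernel δ ε μ x y * l x := fun x hx =>
      mul_nonneg (smoothingKernel_nonneg hε _ _ _) (hb x hx).1
    have h0 : 0 ≤ ∫ x in Set.Icc (0 : ℝ) 1, smoothingKernel δ ε μ x y * l x :=
      setIntegral_nonneg measurableSet_Icc hle
    refine ⟨by linarith, ?_⟩
    refine le_trans ?_ (setIntegral_smoothingKernel hδ.le hε hδε hμ hy).le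
    have hKi : IntegrableOn (fun x => smoothingKernel δ ε μ x y) (Set.Icc (0 : ℝ) 1) :=
      integrableOn_Icc_of_bounded (measurable_smoothingKernel_left _ _ _ _) (C := 1 / ε)
        fun x _ => by
          rw [abs_of_nonneg (smoothingKernel_nonneg hε _ _ _)]
          exact smoothingKernel_le_inv hε _ _ _
    refine setIntegral_mono_on ?_ hKi measurableSet_Icc fun x hx =>
      mul_le_of_le_one_right (smoothingKernel_nonneg hε _ _ _) (hb x hx).2
    refine integrableOn_Icc_of_bounded ((measurable_smoothingKernel_left _ _ _ _).mul hlm)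
      (C := 1 / ε) fun x hx => ?_
    rw [Pi.mul_apply, abs_of_nonneg (hle x hx)]
    exact (mul_le_of_le_one_right (smoothingKernel_nonneg hε _ _ _) (hb x hx).2).trans
      (smoothingKernel_le_inv hε _ _ _)

/-- The key property of the kernel: transporting a convex loss by the kernel costs at most the
average of the loss at the point and the loss of the smoothed density. -/
lemma setIntegral_kernel_mul_le {l : ℝ → ℝ} (hl : ConvexOn ℝ (Set.Icc 0 1) l)
    (hlm : Measurable l) (hb : ∀ x ∈ Set.Icc (0 : ℝ) 1, l x ∈ Set.Icc (0 : ℝ) 1)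
    (hu : IsDensity δ u) (hδ : 0 < δ) (hε : 0 < ε)
    (hδε : δ + 2 * ε ≤ 1 - δ) {y : ℝ} (hy : y ∈ Set.Icc δ (1 - δ)) :
    ∫ x in Set.Icc (0 : ℝ) 1, smoothingKernel δ ε (mean δ u) x y * l x ≤
      (l y + ∫ x in Set.Icc (0 : ℝ) 1, smoothed δ ε u x * l x) / 2 + 9 / 4 * (ε / δ) := by
  -- Jensen replaces `l μ / 2`, at the price of half its error: `3 / 2 + 3 / 4 = 9 / 4`.
  have h1 := setIntegral_smoothingKernel_mul_le hl hlm hb hδ hε hδε (hu.mean_mem hδ.le) hy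
  have h2 := hu.apply_mean_le hl hlm hb hδ hε hδε
  linarith

/-! ## Exponential weights -/

lemma integrableOn_mul_exp (hu : IsDensity δ u) {f : ℝ → ℝ} (hf : Measurable f) {B : ℝ}
    (hB : ∀ x, |f x| ≤ B) :
    IntegrableOn (fun x => u x * Real.exp (f x)) (Set.Icc δ (1 - δ)) := by
  have := hu.integrableOn_mul (g := fun x => Real.exp (f x)) hf.exp (C := Real.exp B) fun x _ => by
    rw [abs_of_pos (Real.exp_pos _)]
    exact Real.exp_le_exp.mpr ((le_abs_self _).trans (hB x))
  simpa only [mul_comm] using this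

lemma integral_mul_exp_pos (hu : IsDensity δ u) {f : ℝ → ℝ} (hf : Measurable f) {B : ℝ}
    (hB : ∀ x, |f x| ≤ B) : 0 < ∫ x in Set.Icc δ (1 - δ), u x * Real.exp (f x) := by
  have := setIntegral_mono_on (hu.integrableOn.const_mul (Real.exp (-B)))
    (hu.integrableOn_mul_exp hf hB) measurableSet_Icc fun x _ => by
      rw [mul_comm]
      exact mul_le_mul_of_nonneg_left
        (Real.exp_le_exp.mpr (neg_le_of_abs_le (hB x))) (hu.nonneg x)
  rw [integral_const_mul, hu.integral_eq_one, mul_one] at this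
  exact (Real.exp_pos _).trans_le this

lemma expTilt (hu : IsDensity δ u) {f : ℝ → ℝ} (hf : Measurable f) {B : ℝ}
    (hB : ∀ x, |f x| ≤ B) :
    IsDensity δ fun x => u x * Real.exp (f x) /
      ∫ y in Set.Icc δ (1 - δ), u y * Real.exp (f y) where
  measurable := (hu.measurable.mul hf.exp).div_const _
  nonneg x := div_nonneg (mul_nonneg (hu.nonneg x) (Real.exp_pos _).le)
    (hu.integral_mul_exp_pos hf hB).le
  pos x hx := div_pos (mul_pos (hu.pos x hx) (Real.exp_pos _)) (hu.integral_mul_exp_pos hf hB)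
  integral_eq_one := by
    rw [integral_div]
    exact div_self (hu.integral_mul_exp_pos hf hB).ne'

end IsDensity

/-- Since `exp x ≥ 1 + x + x ^ 2 / 2`, it suffices that `(1 - x + x ^ 2 / 2) (1 + x + x ^ 2 / 2) = 1
+ x ^ 4 / 4 ≥ 1`. No upper bound on `x` enters, so no smallness of `η` times the loss estimates is
needed. -/
lemma exp_neg_le_quadratic {x : ℝ} (hx : 0 ≤ x) : Real.exp (-x) ≤ 1 - x + x ^ 2 / 2 := by
  have h := Real.quadratic_le_exp_of_nonneg hx
  have hpos : 0 < 1 + x + x ^ 2 / 2 := by positivity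
  rw [Real.exp_neg]
  refine (inv_anti₀ hpos h).trans ?_
  rw [inv_le_iff_one_le_mul₀ hpos]
  nlinarith [sq_nonneg (x ^ 2)]

lemma IsDensity.log_integral_le {δ : ℝ} {u : ℝ → ℝ} (hu : IsDensity δ u) {f : ℝ → ℝ}
    (hf : Measurable f) {η B : ℝ} (hη : 0 < η) (h0 : ∀ x, 0 ≤ f x) (hB : ∀ x, f x ≤ B) :
    Real.log (∫ x in Set.Icc δ (1 - δ), u x * Real.exp (-η * f x)) ≤
      -η * (∫ x in Set.Icc δ (1 - δ), f x * u x) +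
        η ^ 2 / 2 * ∫ x in Set.Icc δ (1 - δ), f x ^ 2 * u x := by
  have hB0 : 0 ≤ B := (h0 0).trans (hB 0)
  have hf' : Measurable fun x => -η * f x := hf.const_mul _
  have hB' : ∀ x, |-η * f x| ≤ η * B := fun x => by
    rw [abs_mul, abs_neg, abs_of_pos hη, abs_of_nonneg (h0 x)]
    exact mul_le_mul_of_nonneg_left (hB x) hη.le
  have hZ := hu.integral_mul_exp_pos hf' hB'
  refine (Real.log_le_sub_one_of_pos hZ).trans ?_
  have i1 : IntegrableOn (fun x => f x * u x) (Set.Icc δ (1 - δ)) :=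
    hu.integrableOn_mul hf fun x _ => by rw [abs_of_nonneg (h0 x)]; exact hB x
  have i2 : IntegrableOn (fun x => f x ^ 2 * u x) (Set.Icc δ (1 - δ)) :=
    hu.integrableOn_mul (hf.pow_const 2) (C := B ^ 2) fun x _ => by
      rw [abs_of_nonneg (sq_nonneg _)]; exact pow_le_pow_left₀ (h0 x) (hB x) 2
  have := setIntegral_mono_on (hu.integrableOn_mul_exp hf' hB')
    ((hu.integrableOn.add (i1.const_mul (-η))).add (i2.const_mul (η ^ 2 / 2)))
    measurableSet_Icc fun x _ => by
      have h := exp_neg_le_quadratic (mul_nonneg hη.le (h0 x))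
      have h' := mul_le_mul_of_nonneg_left h (hu.nonneg x)
      rw [neg_mul]
      refine h'.trans (le_of_eq ?_)
      simp only [Pi.add_apply]
      ring
  have e : ∫ x in Set.Icc δ (1 - δ), ((u + fun x => -η * (f x * u x)) +
      fun x => η ^ 2 / 2 * (f x ^ 2 * u x) : ℝ → ℝ) x = 1 + -η * (∫ x in Set.Icc δ (1 - δ), f x * u x) +
        η ^ 2 / 2 * ∫ x in Set.Icc δ (1 - δ), f x ^ 2 * u x := by
    rw [integral_add' (hu.integrableOn.add (i1.const_mul (-η))) (i2.const_mul (η ^ 2 / 2)),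
      integral_add' hu.integrableOn (i1.const_mul (-η)), integral_const_mul, integral_const_mul,
      hu.integral_eq_one]
  rw [e] at this
  linarith

end TargetedMarketing

namespace TargetedMarketing

/-! ### Admissible parameters and invariants of the states -/

variable {n K : ℕ}

/-- Admissible parameters of the algorithm. -/
structure Params.Admissible (P : Params) : Prop where
  η_pos : 0 < P.η
  δ_pos : 0 < P.δ
  ε_pos : 0 < P.ε
  fits : P.δ + 2 * P.ε ≤ 1 - P.δ
  γ_eq : P.γ = P.η * Real.log (Real.exp 1 / P.ε)

namespace Params.Admissible

variable {P : Params} (hP : P.Admissible)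
include hP

lemma ε_le_one : P.ε ≤ 1 := by linarith [hP.δ_pos, hP.ε_pos, hP.fits]

lemma one_le_log : 1 ≤ Real.log (Real.exp 1 / P.ε) := by
  rw [Real.log_div (Real.exp_ne_zero _) hP.ε_pos.ne', Real.log_exp]
  linarith [Real.log_nonpos hP.ε_pos.le hP.ε_le_one]

lemma γ_pos : 0 < P.γ := by
  rw [hP.γ_eq]
  exact mul_pos hP.η_pos (by linarith [hP.one_le_log])

end Params.Admissible

/-- The invariants of the states of the algorithm. -/
structure State.Regular (P : Params) (s : State n K) : Prop where
  price_pos : ∀ j, 0 < s.price j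
  price_sum : ∑ j, s.price j = 1
  dens : ∀ i j, IsDensity P.δ (s.dens i j)

lemma State.Regular.price_le_one {P : Params} {s : State n K} (hs : s.Regular P) (j) :
    s.price j ≤ 1 := by
  rw [← hs.price_sum]
  exact Finset.single_le_sum (fun j _ => (hs.price_pos j).le) (Finset.mem_univ j)

lemma State.regular_init {P : Params} (hP : P.Admissible) (n K : ℕ) :
    (State.init P n K).Regular P where
  price_pos j := by simp only [State.init]; positivity
  price_sum := by
    simp only [State.init, Finset.sum_const, Finset.card_univ, Fintype.card_fin, nsmul_eq_mul]
    push_cast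
    field_simp
  dens i j := by
    have h : 0 < 1 - 2 * P.δ := by linarith [hP.ε_pos, hP.fits]
    simp only [State.init]
    refine ⟨measurable_const.indicator measurableSet_Icc,
      Set.indicator_nonneg fun _ _ => by positivity, fun x hx => ?_, ?_⟩
    · rw [Set.indicator_of_mem hx]; positivity
    · rw [setIntegral_indicator measurableSet_Icc, Set.inter_self, setIntegral_const,
        Measure.real, Real.volume_Icc, ENNReal.toReal_ofReal (by linarith), smul_eq_mul,
        show 1 - P.δ - P.δ = 1 - 2 * P.δ by ring]
      exact mul_one_div_cancel h.ne'

lemma profit_mem (r : Round n K) (i : Fin n) : profit r i ∈ Set.Icc (-1 : ℝ) 1 := by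
  unfold profit
  have hp := (priceLevel K r.1.1).2
  have hd := (r.2 i).2
  have hc := (r.1.2 i).2
  have h1 : 0 ≤ (priceLevel K r.1.1 : ℝ) * (r.2 i : ℝ) := mul_nonneg hp.1 hd.1
  have h2 : (priceLevel K r.1.1 : ℝ) * (r.2 i : ℝ) ≤ 1 := mul_le_one₀ hp.2 hd.1 hd.2
  exact ⟨by linarith [hc.2], by linarith [hc.1]⟩

lemma loss_nonneg (r : Round n K) (i : Fin n) : 0 ≤ loss r i := by
  have := (profit_mem r i).2
  unfold loss
  linarith

lemma loss_le_one (r : Round n K) (i : Fin n) : loss r i ≤ 1 := by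
  have := (profit_mem r i).1
  unfold loss
  linarith

/-- The coefficient of the kernel in the loss estimator. -/
noncomputable def State.coeff (P : Params) (s : State n K) (r : Round n K) (i : Fin n) (p : Fin (K + 1)) : ℝ :=
  (loss r i * (if r.1.1 = p then 1 else 0)) /
    (s.costDens P i r.1.1 (r.1.2 i) * (s.price r.1.1 + P.γ))

section Regular

variable {P : Params} {s : State n K}

lemma State.coeff_nonneg (hP : P.Admissible) (hs : s.Regular P) (r : Round n K) (i : Fin n)
    (p : Fin (K + 1)) : 0 ≤ s.coeff P r i p := by
  refine div_nonneg (mul_nonneg (loss_nonneg r i) (by split_ifs <;> simp)) (mul_nonneg ?_ ?_)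
  · exact (hs.dens _ _).smoothed_nonneg hP.ε_pos _
  · linarith [hs.price_pos r.1.1, hP.γ_pos]

lemma State.fHat_nonneg (hP : P.Admissible) (hs : s.Regular P) (r : Round n K) (i : Fin n)
    (c : ℝ) (p : Fin (K + 1)) : 0 ≤ s.fHat P r i c p :=
  mul_nonneg (State.coeff_nonneg hP hs r i p) (smoothingKernel_nonneg hP.ε_pos _ _ _)

/-- This bound depends on the round and can be huge; it serves only to make the exponential-weights
integrals finite. -/
lemma State.fHat_le (hP : P.Admissible) (hs : s.Regular P) (r : Round n K) (i : Fin n)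
    (c : ℝ) (p : Fin (K + 1)) : s.fHat P r i c p ≤ s.coeff P r i p * (1 / P.ε) :=
  mul_le_mul_of_nonneg_left (smoothingKernel_le_inv hP.ε_pos _ _ _)
    (State.coeff_nonneg hP hs r i p)

lemma State.measurable_fHat_cost (r : Round n K) (i : Fin n) (p : Fin (K + 1)) :
    Measurable fun c => s.fHat P r i c p :=
  (measurable_smoothingKernel_right _ _ _ _).const_mul _

lemma State.abs_neg_mul_fHat_le (hP : P.Admissible) (hs : s.Regular P) (r : Round n K)
    (i : Fin n) (p : Fin (K + 1)) (c : ℝ) :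
    |-P.η * s.fHat P r i c p| ≤ P.η * (s.coeff P r i p * (1 / P.ε)) := by
  rw [abs_mul, abs_neg, abs_of_pos hP.η_pos, abs_of_nonneg (State.fHat_nonneg hP hs r i c p)]
  exact mul_le_mul_of_nonneg_left (State.fHat_le hP hs r i c p) hP.η_pos.le

lemma State.Regular.priceNorm_pos (hs : s.Regular P) (g : Fin (K + 1) → ℝ) :
    0 < ∑ j, s.price j * Real.exp (g j) :=
  Finset.sum_pos (fun j _ => mul_pos (hs.price_pos j) (Real.exp_pos _)) Finset.univ_nonempty

lemma State.Regular.update (hP : P.Admissible) (hs : s.Regular P) (r : Round n K) :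
    (s.update P r).Regular P where
  price_pos j := div_pos (mul_pos (hs.price_pos j) (Real.exp_pos _)) (hs.priceNorm_pos _)
  price_sum := by
    simp only [State.update]
    rw [← Finset.sum_div]
    exact div_self (hs.priceNorm_pos _).ne'
  dens i j := (hs.dens i j).expTilt ((State.measurable_fHat_cost r i j).const_mul _)
    (State.abs_neg_mul_fHat_le hP hs r i j)

lemma regular_stateAt (hP : P.Admissible) : ∀ (t : ℕ) (h : Hist n K t), (stateAt P t h).Regular P
  | 0, _ => State.regular_init hP n K
  | t + 1, h => (regular_stateAt hP t h.1).update hP h.2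

/-! ## Measurability of the state -/

/-- A family of states depending measurably on a parameter. -/
structure MeasurableState {α : Type*} [MeasurableSpace α] (s : α → State n K) : Prop where
  price : ∀ j, Measurable fun a => (s a).price j
  dens : ∀ i j, Measurable fun z : α × ℝ => (s z.1).dens i j z.2

namespace MeasurableState

variable {α : Type*} [MeasurableSpace α] {s : α → State n K} (hs : MeasurableState s)
include hs

lemma price_comp {β : Type*} [MeasurableSpace β] {a : β → α} (ha : Measurable a)
    {j : β → Fin (K + 1)} (hj : Measurable j) : Measurable fun b => (s (a b)).price (j b) := by
  have : Measurable fun z : α × Fin (K + 1) => (s z.1).price z.2 :=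
    measurable_from_prod_countable_left fun j => hs.price j
  exact this.comp (ha.prodMk hj)

lemma costDens (P : Params) (i : Fin n) {β : Type*} [MeasurableSpace β] {a : β → α}
    (ha : Measurable a) {j : β → Fin (K + 1)} (hj : Measurable j) {x : β → ℝ}
    (hx : Measurable x) : Measurable fun b => (s (a b)).costDens P i (j b) (x b) := by
  have : Measurable fun z : (α × ℝ) × Fin (K + 1) => (s z.1.1).costDens P i z.2 z.1.2 :=
    measurable_from_prod_countable_left fun j => measurable_smoothed (u := fun a => (s a).dens i j) (hs.dens i j)
  exact this.comp ((ha.prodMk hx).prodMk hj)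

end MeasurableState

lemma measurable_priceLevel : Measurable fun j : Fin (K + 1) => (priceLevel K j : ℝ) :=
  measurable_of_finite _

lemma measurable_loss (i : Fin n) : Measurable fun r : Round n K => loss r i := by
  have h1 : Measurable fun r : Round n K => (priceLevel K r.1.1 : ℝ) :=
    measurable_priceLevel.comp (measurable_fst.comp measurable_fst)
  have h2 : Measurable fun r : Round n K => (r.2 i : ℝ) :=
    measurable_subtype_coe.comp ((measurable_pi_apply i).comp measurable_snd)
  have h3 : Measurable fun r : Round n K => (r.1.2 i : ℝ) :=
    measurable_subtype_coe.comp
      ((measurable_pi_apply i).comp (measurable_snd.comp measurable_fst))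
  exact (((h1.mul h2).sub h3).const_sub 1).div_const 2

lemma MeasurableState.update {α : Type*} [MeasurableSpace α] {s : α → State n K}
    (hs : MeasurableState s) (P : Params) :
    MeasurableState fun z : α × Round n K => (s z.1).update P z.2 := by
  have hj : Measurable fun z : α × Round n K => z.2.1.1 := by fun_prop
  have hpr : Measurable fun z : α × Round n K => (s z.1).price z.2.1.1 :=
    hs.price_comp measurable_fst hj
  have hind : ∀ p : Fin (K + 1), Measurable fun z : α × Round n K =>
      (if z.2.1.1 = p then (1 : ℝ) else 0) := fun p =>
    (measurable_of_finite fun j : Fin (K + 1) => (if j = p then (1 : ℝ) else 0)).comp hj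
  have hl : ∀ i, Measurable fun z : α × Round n K => loss z.2 i := fun i =>
    (measurable_loss i).comp measurable_snd
  refine ⟨fun p => ?_, fun i p => ?_⟩
  · have hh : ∀ p, Measurable fun z : α × Round n K => (s z.1).hHat P z.2 p := fun p =>
      ((((Finset.measurable_fun_sum _ fun i _ => hl i).mul (hind p)).div
        (hpr.add_const _)).const_mul _).add
        ((((((hs.price p).comp measurable_fst).add_const P.γ).const_div 1).const_sub _).const_mul _)
    have hw : ∀ p, Measurable fun z : α × Round n K =>
        (s z.1).price p * Real.exp (-P.η * (s z.1).hHat P z.2 p) := fun p =>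
      ((hs.price p).comp measurable_fst).mul ((hh p).const_mul _).exp
    exact (hw p).div (Finset.measurable_fun_sum _ fun p _ => hw p)
  · have hx : Measurable fun z : α × Round n K => (z.2.1.2 i : ℝ) :=
      measurable_subtype_coe.comp ((measurable_pi_apply i).comp
        (measurable_snd.comp (measurable_fst.comp measurable_snd)))
    have hco : Measurable fun z : α × Round n K => (s z.1).coeff P z.2 i p :=
      ((hl i).mul (hind p)).div ((hs.costDens P i measurable_fst hj hx).mul (hpr.add_const _))
    have hker : Measurable fun z : (α × Round n K) × ℝ =>
        smoothingKernel P.δ P.ε (mean P.δ ((s z.1.1).dens i p)) (z.1.2.1.2 i) z.2 :=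
      (measurable_smoothingKernel _ _).comp
        (((measurable_mean (u := fun a => (s a).dens i p) (hs.dens i p)).comp (measurable_fst.comp measurable_fst)).prodMk
          ((hx.comp measurable_fst).prodMk measurable_snd))
    have hw : Measurable fun z : (α × Round n K) × ℝ =>
        (s z.1.1).dens i p z.2 * Real.exp (-P.η * (s z.1.1).fHat P z.1.2 i z.2 p) :=
      ((hs.dens i p).comp ((measurable_fst.comp measurable_fst).prodMk measurable_snd)).mul
        (((hco.comp measurable_fst).mul hker).const_mul _).exp
    exact hw.div ((hw.stronglyMeasurable.integral_prod_right'
      (ν := volume.restrict (Set.Icc P.δ (1 - P.δ)))).measurable.comp measurable_fst)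

lemma measurableState_stateAt (P : Params) (n K : ℕ) :
    ∀ t, MeasurableState fun h : Hist n K t => stateAt P t h
  | 0 => ⟨fun _ => measurable_const,
      fun _ _ => (measurable_const.indicator measurableSet_Icc).comp measurable_snd⟩
  | t + 1 => (measurableState_stateAt P n K t).update P

lemma MeasurableState.choiceDens {α : Type*} [MeasurableSpace α] {s : α → State n K}
    (hs : MeasurableState s) (P : Params) :
    Measurable fun z : α × Choice n K => (s z.1).choiceDens P z.2 := by
  have hj : Measurable fun z : α × Choice n K => z.2.1 := by fun_prop
  refine (hs.price_comp measurable_fst hj).mul (Finset.measurable_fun_prod _ fun i _ => ?_)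
  exact hs.costDens P i measurable_fst hj (measurable_subtype_coe.comp
    ((measurable_pi_apply i).comp (measurable_snd.comp measurable_snd)))

end Regular

end TargetedMarketing

namespace TargetedMarketing

variable {n K : ℕ} {P : Params} {s : State n K}

/-! ## Exponential weights, one round at a time -/

/-- The biased importance weight of the price level `p` when `j` is played. -/
noncomputable def State.weight (P : Params) (s : State n K) (p j : Fin (K + 1)) : ℝ :=
  if j = p then 1 / (s.price p + P.γ) else 0

/-- A lower bound for the growth of `log u_{t,i}(c | p) / η` in one round. -/
noncomputable def State.costGain (P : Params) (s : State n K) (i : Fin n) (p : Fin (K + 1)) (c : ℝ)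
    (r : Round n K) : ℝ :=
  loss r i * (s.weight P p r.1.1 *
      (s.costDens P i p (r.1.2 i) / s.costDens P i p (r.1.2 i))) -
    loss r i * (s.weight P p r.1.1 *
      (smoothingKernel P.δ P.ε (mean P.δ (s.dens i p)) (r.1.2 i) c /
        s.costDens P i p (r.1.2 i))) -
    P.η / 2 * (s.weight P p r.1.1 ^ 2 *
      (1 / max |(r.1.2 i : ℝ) - mean P.δ (s.dens i p)| P.ε / s.costDens P i p (r.1.2 i)))

/-- A lower bound for the growth of `log q_{t,0}(p) / η` in one round. -/
noncomputable def State.priceGain (P : Params) (s : State n K) (p : Fin (K + 1))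
    (r : Round n K) : ℝ :=
  1 / (n : ℝ) * (∑ i, loss r i) * (1 - s.weight P p r.1.1) -
    (P.γ + P.η) / (s.price r.1.1 + P.γ) + 3 * P.γ / (s.price p + P.γ) - 9 * P.η -
    3 * P.γ * ((K : ℝ) + 1)

lemma State.coeff_eq (r : Round n K) (i : Fin n) (p : Fin (K + 1)) :
    s.coeff P r i p = loss r i * s.weight P p r.1.1 / s.costDens P i p (r.1.2 i) := by
  unfold State.coeff State.weight
  split_ifs with h
  · rw [h, mul_one, mul_one_div, div_div, mul_comm (s.costDens P i p _)]
  · simp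

lemma State.weight_nonneg (hP : P.Admissible) (hs : s.Regular P) (p j : Fin (K + 1)) :
    0 ≤ s.weight P p j := by
  unfold State.weight
  have := hs.price_pos p
  have := hP.γ_pos
  split_ifs <;> positivity

/-- Second-order expansion of the normalizing integral. The mean of the estimator under `u` is its
coefficient times `q`, because smoothing `u` by the kernel is exactly `q`; the second moment is
bounded through the envelope. The quotient `q / q` inside `State.costGain` stands for `1`, but it is
`0` where `q` vanishes, which keeps the identity valid for every round. -/
lemma State.log_dens_add_le (hP : P.Admissible) (hs : s.Regular P) (r : Round n K) (i : Fin n)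
    (p : Fin (K + 1)) {c : ℝ} (hc : c ∈ Set.Icc P.δ (1 - P.δ)) :
    Real.log (s.dens i p c) + P.η * s.costGain P i p c r ≤
      Real.log ((s.update P r).dens i p c) := by
  have hu := hs.dens i p
  have hq : 0 ≤ s.costDens P i p (r.1.2 i) := hu.smoothed_nonneg hP.ε_pos _
  have hZ := hu.integral_mul_exp_pos ((State.measurable_fHat_cost r i p).const_mul (-P.η))
    (State.abs_neg_mul_fHat_le hP hs r i p)
  have hlog := hu.log_integral_le (State.measurable_fHat_cost (P := P) (s := s) r i p) hP.η_pos
    (fun x => State.fHat_nonneg hP hs r i x p) (fun x => State.fHat_le hP hs r i x p)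
  have e1 : ∫ x in Set.Icc P.δ (1 - P.δ), s.fHat P r i x p * s.dens i p x =
      s.coeff P r i p * s.costDens P i p (r.1.2 i) := by
    rw [State.costDens, smoothed, ← integral_const_mul]
    refine integral_congr_ae (Filter.Eventually.of_forall fun x => ?_)
    simp only [State.fHat, State.coeff]
    ring
  have e2 : ∫ x in Set.Icc P.δ (1 - P.δ), s.fHat P r i x p ^ 2 * s.dens i p x =
      s.coeff P r i p ^ 2 * ∫ y in Set.Icc P.δ (1 - P.δ),
        smoothingKernel P.δ P.ε (mean P.δ (s.dens i p)) (r.1.2 i) y ^ 2 * s.dens i p y := by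
    rw [← integral_const_mul]
    refine integral_congr_ae (Filter.Eventually.of_forall fun x => ?_)
    simp only [State.fHat, State.coeff]
    ring
  have e3 : ∫ x in Set.Icc P.δ (1 - P.δ), s.fHat P r i x p ^ 2 * s.dens i p x ≤
      s.weight P p r.1.1 ^ 2 *
      (1 / max |(r.1.2 i : ℝ) - mean P.δ (s.dens i p)| P.ε / s.costDens P i p (r.1.2 i)) := by
    rw [e2]
    refine (mul_le_mul_of_nonneg_left (hu.integral_kernel_sq_mul_le hP.ε_pos _)
      (sq_nonneg _)).trans ?_
    have hl : loss r i ^ 2 ≤ 1 := pow_le_one₀ (loss_nonneg r i) (loss_le_one r i)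
    change s.coeff P r i p ^ 2 * (_ * s.costDens P i p (r.1.2 i)) ≤ _
    rw [State.coeff_eq]
    set q := s.costDens P i p (r.1.2 i)
    set M := 1 / max |(r.1.2 i : ℝ) - mean P.δ (s.dens i p)| P.ε with hM
    have hM0 : 0 ≤ M := by
      rw [hM]; exact div_nonneg zero_le_one (hP.ε_pos.le.trans (le_max_right _ _))
    have e : (loss r i * s.weight P p r.1.1 / q) ^ 2 * (M * q) =
        loss r i ^ 2 * (s.weight P p r.1.1 ^ 2 * (M / q)) := by
      -- At a zero of `q` both sides are `0`, by the convention for division by zero.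
      rcases eq_or_ne q 0 with h | h
      · simp [h]
      · field_simp
    rw [e]
    exact mul_le_of_le_one_left (by positivity) hl
  have hupd : Real.log ((s.update P r).dens i p c) = Real.log (s.dens i p c) +
      -P.η * s.fHat P r i c p -
      Real.log (∫ x in Set.Icc P.δ (1 - P.δ), s.dens i p x * Real.exp (-P.η * s.fHat P r i x p)) := by
    simp only [State.update]
    rw [Real.log_div (mul_pos (hu.pos c hc) (Real.exp_pos _)).ne' hZ.ne',
      Real.log_mul (hu.pos c hc).ne' (Real.exp_ne_zero _), Real.log_exp]
  have hf : s.fHat P r i c p = loss r i * (s.weight P p r.1.1 *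
      (smoothingKernel P.δ P.ε (mean P.δ (s.dens i p)) (r.1.2 i) c /
        s.costDens P i p (r.1.2 i))) := by
    change s.coeff P r i p * _ = _
    rw [State.coeff_eq]
    ring
  have hfu : s.coeff P r i p * s.costDens P i p (r.1.2 i) = loss r i * (s.weight P p r.1.1 *
      (s.costDens P i p (r.1.2 i) / s.costDens P i p (r.1.2 i))) := by
    rw [State.coeff_eq]
    ring
  have hη := hP.η_pos
  have h3 : P.η ^ 2 / 2 * ∫ x in Set.Icc P.δ (1 - P.δ), s.fHat P r i x p ^ 2 * s.dens i p x ≤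
    P.η ^ 2 / 2 * (s.weight P p r.1.1 ^ 2 *
      (1 / max |(r.1.2 i : ℝ) - mean P.δ (s.dens i p)| P.ε / s.costDens P i p (r.1.2 i))) :=
    mul_le_mul_of_nonneg_left e3 (by positivity)
  rw [hupd, State.costGain, ← hf, ← hfu, ← e1]
  rw [e1] at hlog ⊢
  linarith

lemma sum_loss_div_mem (r : Round n K) : 1 / (n : ℝ) * (∑ i, loss r i) ∈ Set.Icc (0 : ℝ) 1 := by
  have h0 : 0 ≤ ∑ i, loss r i := Finset.sum_nonneg fun i _ => loss_nonneg r i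
  have h1 : ∑ i, loss r i ≤ n := by
    simpa using Finset.sum_le_sum fun i (_ : i ∈ Finset.univ) => loss_le_one r i
  refine ⟨by positivity, ?_⟩
  rw [one_div_mul_eq_div]
  exact div_le_one_of_le₀ h1 (by positivity)

/-- The second summand of `hHat` is `3 b` with `b k = q k / (q k + γ) = 1 - γ / (q k + γ)`. The
comparator level pays `3 b p`, while the normalization refunds the average of `3 b`, which is nearly
`3`. The difference is the gain `3 γ / (q p + γ)` reserved for the variance of the cost learners. -/
lemma State.log_price_add_le (hP : P.Admissible) (hs : s.Regular P) (r : Round n K)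
    (p : Fin (K + 1)) :
    Real.log (s.price p) + P.η * s.priceGain P p r ≤ Real.log ((s.update P r).price p) := by
  have hγ := hP.γ_pos
  have hη := hP.η_pos
  set m := 1 / (n : ℝ) * (∑ i, loss r i) with hm
  obtain ⟨hm0, hm1⟩ : m ∈ Set.Icc (0 : ℝ) 1 := sum_loss_div_mem r
  set j := r.1.1 with hj
  have hQ : ∀ k, 0 < s.price k + P.γ := fun k => by linarith [hs.price_pos k]
  set a : Fin (K + 1) → ℝ := fun k => if j = k then 1 / (s.price k + P.γ) else 0 with ha
  set b : Fin (K + 1) → ℝ := fun k => s.price k / (s.price k + P.γ) with hb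
  have ha0 : ∀ k, 0 ≤ a k := fun k => State.weight_nonneg hP hs k j
  have hb0 : ∀ k, 0 ≤ b k := fun k => div_nonneg (hs.price_pos k).le (hQ k).le
  have hb1 : ∀ k, b k ≤ 1 := fun k => div_le_one_of_le₀ (by linarith) (hQ k).le
  -- The choice `γ = η log (e / ε)` turns the prefactor into `3 γ`, and `γ (1 / γ - 1 / (q + γ)) = q
  -- / (q + γ)`.
  have hh : ∀ k, s.hHat P r k = m * a k + 3 * b k := by
    intro k
    simp only [State.hHat, hm, ha, hb, ← hj]
    have e : 3 * P.η * Real.log (Real.exp 1 / P.ε) = 3 * P.γ := by rw [hP.γ_eq]; ring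
    rw [e]
    have hk := (hQ k).ne'
    congr 1
    · split_ifs with h
      · rw [h]; ring
      · simp
    · field_simp
      ring
  have hhnn : ∀ k, 0 ≤ s.hHat P r k := fun k => by
    rw [hh]
    have := ha0 k
    have := hb0 k
    positivity
  have sa : ∑ k, s.price k * a k = 1 - P.γ / (s.price j + P.γ) := by
    simp only [ha, mul_ite, mul_zero, Finset.sum_ite_eq, Finset.mem_univ, if_true]
    have := (hQ j).ne'
    field_simp
    ring
  have sa2 : ∑ k, s.price k * a k ^ 2 ≤ 1 / (s.price j + P.γ) := by
    have e : ∀ k, s.price k * a k ^ 2 = if j = k then b k * (1 / (s.price k + P.γ)) else 0 := by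
      intro k
      simp only [ha, hb]
      split_ifs
      · ring
      · simp
    simp only [e, Finset.sum_ite_eq, Finset.mem_univ, if_true]
    exact mul_le_of_le_one_left (by have := hQ j; positivity) (hb1 j)
  -- From `b (q + γ) = q` follows `q b = q - γ b`, and there are `K + 1` levels with `b ≤ 1`.
  have sb : 1 - P.γ * ((K : ℝ) + 1) ≤ ∑ k, s.price k * b k := by
    have e : ∀ k, s.price k * b k = s.price k - P.γ * b k := by
      intro k
      have := (hQ k).ne'
      simp only [hb]
      field_simp
      ring
    simp only [e]
    rw [Finset.sum_sub_distrib, hs.price_sum, ← Finset.mul_sum]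
    have : ∑ k, b k ≤ (K : ℝ) + 1 := by
      simpa using Finset.sum_le_sum fun k (_ : k ∈ Finset.univ) => hb1 k
    have := mul_le_mul_of_nonneg_left this hγ.le
    linarith
  have sb2 : ∑ k, s.price k * b k ^ 2 ≤ 1 := by
    rw [← hs.price_sum]
    exact Finset.sum_le_sum fun k _ =>
      mul_le_of_le_one_right (hs.price_pos k).le (pow_le_one₀ (hb0 k) (hb1 k))
  have hZ := hs.priceNorm_pos fun k => -P.η * s.hHat P r k
  have hZle : ∑ k, s.price k * Real.exp (-P.η * s.hHat P r k) ≤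
      1 - P.η * (m * (1 - P.γ / (s.price j + P.γ)) + 3 * (1 - P.γ * ((K : ℝ) + 1))) +
        P.η ^ 2 / 2 * (2 * (1 / (s.price j + P.γ)) + 18) := by
    have hterm : ∀ k, s.price k * Real.exp (-P.η * s.hHat P r k) ≤
        s.price k - P.η * (m * (s.price k * a k) + 3 * (s.price k * b k)) +
          P.η ^ 2 / 2 * (2 * (s.price k * a k ^ 2) + 18 * (s.price k * b k ^ 2)) := by
      intro k
      have h := exp_neg_le_quadratic (mul_nonneg hη.le (hhnn k))
      rw [neg_mul]
      refine (mul_le_mul_of_nonneg_left h (hs.price_pos k).le).trans ?_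
      -- This is `(x + y) ^ 2 ≤ 2 x ^ 2 + 2 y ^ 2` with `y = 3 b`, hence the `18`.
      have hsq : s.hHat P r k ^ 2 ≤ 2 * a k ^ 2 + 18 * b k ^ 2 := by
        rw [hh]
        have : m ^ 2 * a k ^ 2 ≤ a k ^ 2 :=
          mul_le_of_le_one_left (sq_nonneg _) (pow_le_one₀ hm0 hm1)
        nlinarith [sq_nonneg (m * a k - 3 * b k)]
      have := mul_le_mul_of_nonneg_left hsq
        (mul_nonneg (hs.price_pos k).le (by positivity : 0 ≤ P.η ^ 2 / 2))
      rw [mul_pow]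
      have e : s.price k * (1 - P.η * s.hHat P r k + P.η ^ 2 * s.hHat P r k ^ 2 / 2) =
        s.price k - P.η * (s.price k * s.hHat P r k) +
          s.price k * (P.η ^ 2 / 2) * s.hHat P r k ^ 2 := by ring
      rw [e]
      have e' : s.price k * s.hHat P r k = m * (s.price k * a k) + 3 * (s.price k * b k) := by
        rw [hh]; ring
      rw [e']
      linarith
    refine (Finset.sum_le_sum fun k _ => hterm k).trans ?_
    rw [Finset.sum_add_distrib, Finset.sum_sub_distrib, ← Finset.mul_sum, ← Finset.mul_sum,
      Finset.sum_add_distrib, Finset.sum_add_distrib, ← Finset.mul_sum, ← Finset.mul_sum,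
      ← Finset.mul_sum, ← Finset.mul_sum, hs.price_sum, sa]
    have h1 := mul_le_mul_of_nonneg_left sb (by positivity : 0 ≤ P.η * 3)
    have h2 := mul_le_mul_of_nonneg_left sa2 (by positivity : 0 ≤ P.η ^ 2 / 2 * 2)
    have h3 := mul_le_mul_of_nonneg_left sb2 (by positivity : 0 ≤ P.η ^ 2 / 2 * 18)
    linarith
  have hlogZ := Real.log_le_sub_one_of_pos hZ
  have hupd : Real.log ((s.update P r).price p) = Real.log (s.price p) + -P.η * s.hHat P r p -
      Real.log (∑ k, s.price k * Real.exp (-P.η * s.hHat P r k)) := by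
    simp only [State.update]
    rw [Real.log_div (mul_pos (hs.price_pos p) (Real.exp_pos _)).ne' hZ.ne',
      Real.log_mul (hs.price_pos p).ne' (Real.exp_ne_zero _), Real.log_exp]
  have hap : s.weight P p j = a p := rfl
  have hbp : b p = 1 - P.γ / (s.price p + P.γ) := by
    have := (hQ p).ne'
    simp only [hb]
    field_simp
    ring
  rw [hupd, State.priceGain, ← hm, ← hj, hh p, hap, hbp]
  have hmg : P.η * (m * (P.γ / (s.price j + P.γ))) ≤ P.η * (P.γ / (s.price j + P.γ)) := by
    have := hQ j
    exact mul_le_mul_of_nonneg_left (mul_le_of_le_one_left (by positivity) hm1) hη.le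
  have e4 : P.η * ((P.γ + P.η) / (s.price j + P.γ)) = P.η * (P.γ / (s.price j + P.γ)) +
      P.η ^ 2 / 2 * (2 * (1 / (s.price j + P.γ))) := by ring
  have e5 : 3 * P.γ / (s.price p + P.γ) = 3 * (P.γ / (s.price p + P.γ)) := by ring
  rw [e5]
  linarith

end TargetedMarketing

namespace TargetedMarketing

open scoped ENNReal

variable {n K : ℕ} {P : Params}

/-! ## The law of one round -/

lemma lintegral_unitInterval (f : ℝ → ℝ≥0∞) :
    ∫⁻ x : unitInterval, f x = ∫⁻ x in Set.Icc (0 : ℝ) 1, f x :=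
  lintegral_subtype_comap measurableSet_Icc f

/-- The coordinates are independent under the product measure. -/
lemma lintegral_prod_pi {ι α : Type*} [Fintype ι] [MeasurableSpace α] (μ : Measure α)
    [IsProbabilityMeasure μ] {f : ι → α → ℝ≥0∞} (hf : ∀ i, Measurable (f i)) :
    ∫⁻ c : ι → α, ∏ i, f i (c i) ∂(Measure.pi fun _ => μ) = ∏ i, ∫⁻ x, f i x ∂μ := by
  have hind := iIndepFun_pi (μ := fun _ : ι => μ) (X := f) fun i => (hf i).aemeasurable
  have := lintegral_prod_eq_prod_lintegral_of_indepFun Finset.univ _ hind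
    fun i => (hf i).comp (measurable_pi_apply i)
  refine this.trans (Finset.prod_congr rfl fun i _ => ?_)
  exact (measurePreserving_eval (fun _ : ι => μ) i).lintegral_comp (hf i)

/-- Integrating a function of one coordinate against a product of densities. -/
lemma lintegral_prod_mul_eval {ι α : Type*} [Fintype ι] [DecidableEq ι] [MeasurableSpace α]
    (μ : Measure α) [IsProbabilityMeasure μ] {f : ι → α → ℝ≥0∞} (hf : ∀ i, Measurable (f i))
    (h1 : ∀ i, ∫⁻ x, f i x ∂μ = 1) (i : ι) {g : α → ℝ≥0∞} (hg : Measurable g) :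
    ∫⁻ c : ι → α, (∏ k, f k (c k)) * g (c i) ∂(Measure.pi fun _ => μ) =
      ∫⁻ x, f i x * g x ∂μ := by
  -- The test function is absorbed into the `i`-th factor; all other factors then integrate to `1`.
  set F : ι → α → ℝ≥0∞ := fun k => if k = i then fun x => f k x * g x else f k with hF
  have hFm : ∀ k, Measurable (F k) := fun k => by
    simp only [hF]
    split_ifs
    · exact (hf k).mul hg
    · exact hf k
  have e : ∀ c : ι → α, (∏ k, f k (c k)) * g (c i) = ∏ k, F k (c k) := by
    intro c
    have : ∀ k, F k (c k) = f k (c k) * if k = i then g (c i) else 1 := by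
      intro k
      simp only [hF]
      split_ifs with h
      · rw [h]
      · rw [mul_one]
    simp only [this, Finset.prod_mul_distrib, Finset.prod_ite_eq', Finset.mem_univ, if_true]
  simp only [e]
  rw [lintegral_prod_pi μ hFm, ← Finset.mul_prod_erase _ _ (Finset.mem_univ i)]
  have h : ∏ k ∈ Finset.univ.erase i, ∫⁻ x, F k x ∂μ = 1 :=
    Finset.prod_eq_one fun k hk => by
      simp only [hF, if_neg (Finset.ne_of_mem_erase hk), h1]
  rw [h, mul_one]
  simp [hF]

/-- The importance weights contain `1 / q`, which has no useful pointwise bound. Nonnegative pieces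
are therefore computed in `ℝ≥0∞` first, and integrability is read off from the result. -/
lemma integrable_of_lintegral_le {α : Type*} [MeasurableSpace α] {μ : Measure α} {X : α → ℝ}
    (hX : Measurable X) (h0 : ∀ a, 0 ≤ X a) {x : ℝ} (h : ∫⁻ a, ENNReal.ofReal (X a) ∂μ ≤ ENNReal.ofReal x) :
    Integrable X μ :=
  ⟨hX.aestronglyMeasurable, (hasFiniteIntegral_iff_ofReal (Filter.Eventually.of_forall h0)).mpr
    (h.trans_lt ENNReal.ofReal_lt_top)⟩

lemma integral_le_of_lintegral_le {α : Type*} [MeasurableSpace α] {μ : Measure α} {X : α → ℝ}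
    (hX : Measurable X) (h0 : ∀ a, 0 ≤ X a) {x : ℝ} (hx : 0 ≤ x)
    (h : ∫⁻ a, ENNReal.ofReal (X a) ∂μ ≤ ENNReal.ofReal x) : ∫ a, X a ∂μ ≤ x := by
  rw [integral_eq_lintegral_of_nonneg_ae (Filter.Eventually.of_forall h0)
    hX.aestronglyMeasurable]
  exact ENNReal.toReal_le_of_le_ofReal hx h

lemma integral_eq_of_lintegral_eq {α : Type*} [MeasurableSpace α] {μ : Measure α} {X : α → ℝ}
    (hX : Measurable X) (h0 : ∀ a, 0 ≤ X a) {x : ℝ} (hx : 0 ≤ x)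
    (h : ∫⁻ a, ENNReal.ofReal (X a) ∂μ = ENNReal.ofReal x) : ∫ a, X a ∂μ = x := by
  rw [integral_eq_lintegral_of_nonneg_ae (Filter.Eventually.of_forall h0)
    hX.aestronglyMeasurable, h, ENNReal.toReal_ofReal hx]

section Policy

variable {t : ℕ}

lemma measurable_choiceDens (P : Params) (n K t : ℕ) :
    Measurable (Function.uncurry fun (h : Hist n K t) (a : Choice n K) =>
      ENNReal.ofReal ((stateAt P t h).choiceDens P a)) :=
  ((measurableState_stateAt P n K t).choiceDens P).ennreal_ofReal

lemma lintegral_policy (h : Hist n K t) {g : Choice n K → ℝ≥0∞} (hg : Measurable g) :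
    ∫⁻ a, g a ∂(policy P n K t h) = ∑ j, ∫⁻ c : Fin n → unitInterval,
      ENNReal.ofReal ((stateAt P t h).choiceDens P (j, c)) * g (j, c) := by
  have hm : Measurable fun a => ENNReal.ofReal ((stateAt P t h).choiceDens P a) * g a :=
    ((measurable_choiceDens P n K t).comp measurable_prodMk_left).mul hg
  rw [policy, Kernel.lintegral_withDensity _ (measurable_choiceDens P n K t) h hg,
    Kernel.const_apply, lintegral_prod _ hm.aemeasurable, lintegral_count, tsum_fintype]

lemma State.Regular.costDens_nonneg (hP : P.Admissible) {s : State n K} (hs : s.Regular P)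
    (i : Fin n) (j : Fin (K + 1)) (x : ℝ) : 0 ≤ s.costDens P i j x :=
  (hs.dens i j).smoothed_nonneg hP.ε_pos x

lemma State.Regular.ofReal_choiceDens (hP : P.Admissible) {s : State n K} (hs : s.Regular P)
    (j : Fin (K + 1)) (c : Fin n → unitInterval) :
    ENNReal.ofReal (s.choiceDens P (j, c)) =
      ENNReal.ofReal (s.price j) * ∏ i, ENNReal.ofReal (s.costDens P i j (c i)) := by
  rw [State.choiceDens, ENNReal.ofReal_mul (hs.price_pos j).le,
    ENNReal.ofReal_prod_of_nonneg fun i _ => hs.costDens_nonneg hP i j _]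

lemma State.Regular.measurable_costDens {s : State n K} (hs : s.Regular P) (i : Fin n)
    (j : Fin (K + 1)) : Measurable (s.costDens P i j) :=
  (hs.dens i j).measurable_smoothed

lemma State.Regular.lintegral_costDens (hP : P.Admissible) {s : State n K} (hs : s.Regular P)
    (i : Fin n) (j : Fin (K + 1)) :
    ∫⁻ x : unitInterval, ENNReal.ofReal (s.costDens P i j x) = 1 := by
  have hnn := hs.costDens_nonneg hP i j
  have hi : IntegrableOn (s.costDens P i j) (Set.Icc 0 1) :=
    integrableOn_Icc_of_bounded (hs.measurable_costDens i j) (C := 1 / P.ε) fun x _ => by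
      rw [abs_of_nonneg (hnn x)]
      exact (hs.dens i j).smoothed_le hP.ε_pos x
  rw [lintegral_unitInterval fun x => ENNReal.ofReal (s.costDens P i j x),
    ← ofReal_integral_eq_lintegral_ofReal hi (Filter.Eventually.of_forall hnn)]
  unfold State.costDens
  rw [(hs.dens i j).integral_smoothed hP.δ_pos.le hP.ε_pos hP.fits, ENNReal.ofReal_one]

/-- The joint law of the price level and of the cost of one market. -/
lemma lintegral_policy_eval (hP : P.Admissible) (h : Hist n K t) (i : Fin n)
    {φ : Fin (K + 1) → ℝ → ℝ≥0∞} (hφ : ∀ j, Measurable (φ j)) :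
    ∫⁻ a, φ a.1 (a.2 i) ∂(policy P n K t h) =
      ∑ j, ENNReal.ofReal ((stateAt P t h).price j) * ∫⁻ x in Set.Icc (0 : ℝ) 1,
        ENNReal.ofReal ((stateAt P t h).costDens P i j x) * φ j x := by
  classical
  have hs := regular_stateAt hP t h
  have hφ' : Measurable fun a : Choice n K => φ a.1 (a.2 i) := by
    have : Measurable fun z : Fin (K + 1) × ℝ => φ z.1 z.2 := measurable_from_prod_countable_right hφ
    exact this.comp (measurable_fst.prodMk (measurable_subtype_coe.comp
      ((measurable_pi_apply i).comp measurable_snd)))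
  rw [lintegral_policy h hφ']
  refine Finset.sum_congr rfl fun j _ => ?_
  simp only [hs.ofReal_choiceDens hP, mul_assoc]
  have hm : ∀ k, Measurable fun x : unitInterval =>
      ENNReal.ofReal ((stateAt P t h).costDens P k j x) := fun k =>
    ((hs.measurable_costDens k j).comp measurable_subtype_coe).ennreal_ofReal
  have hmi : Measurable fun x : unitInterval => φ j x := (hφ j).comp measurable_subtype_coe
  rw [lintegral_const_mul]
  · congr 1
    refine (lintegral_prod_mul_eval (volume : Measure unitInterval) hm
      (fun k => hs.lintegral_costDens hP k j) i hmi).trans ?_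
    exact lintegral_unitInterval fun x => ENNReal.ofReal ((stateAt P t h).costDens P i j x) * φ j x
  · exact (Finset.measurable_fun_prod _ fun k _ => (hm k).comp (measurable_pi_apply k)).mul
      (hmi.comp (measurable_pi_apply i))

lemma isMarkovKernel_policy (hP : P.Admissible) (n K t : ℕ) : IsMarkovKernel (policy P n K t) := by
  refine ⟨fun h => ⟨?_⟩⟩
  have hs := regular_stateAt hP t h
  rw [← lintegral_one, lintegral_policy h measurable_const]
  have hj : ∀ j, ∫⁻ c : Fin n → unitInterval,
      ENNReal.ofReal ((stateAt P t h).choiceDens P (j, c)) * 1 =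
        ENNReal.ofReal ((stateAt P t h).price j) := by
    intro j
    have hm : ∀ k, Measurable fun x : unitInterval =>
        ENNReal.ofReal ((stateAt P t h).costDens P k j x) := fun k =>
      ((hs.measurable_costDens k j).comp measurable_subtype_coe).ennreal_ofReal
    simp only [hs.ofReal_choiceDens hP, mul_one]
    have hm' : Measurable fun c : Fin n → unitInterval =>
        ∏ k, ENNReal.ofReal ((stateAt P t h).costDens P k j (c k)) :=
      Finset.measurable_fun_prod _ fun k _ => (hm k).comp (measurable_pi_apply k)
    rw [lintegral_const_mul _ hm']
    have := lintegral_prod_pi (volume : Measure unitInterval) hm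
    simp only [hs.lintegral_costDens hP, Finset.prod_const_one] at this
    refine (congrArg _ this).trans (mul_one _)
  simp only [hj]
  rw [← ENNReal.ofReal_sum_of_nonneg fun j _ => (hs.price_pos j).le, hs.price_sum,
    ENNReal.ofReal_one]

end Policy

/-- The law of a round given the history. -/
noncomputable def roundKernel (P : Params) (E : Environment n) (K t : ℕ) :
    Kernel (Hist n K t) (Round n K) :=
  (policy P n K t).compProd (E.response K t)

instance (E : Environment n) (K t : ℕ) : IsMarkovKernel (E.response K t) := by
  unfold Environment.response; infer_instance

lemma isMarkovKernel_roundKernel (hP : P.Admissible) (E : Environment n) (K t : ℕ) :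
    IsMarkovKernel (roundKernel P E K t) := by
  have := isMarkovKernel_policy hP n K t
  unfold roundKernel
  infer_instance

/-- The expected normalized loss of market `i` in round `t`, as a function of the cost. -/
noncomputable def Environment.meanLoss (E : Environment n) (t : ℕ) (i : Fin n) (p : unitInterval)
    (x : ℝ) : ℝ :=
  (1 - ((p : ℝ) * Set.IccExtend zero_le_one (fun x : unitInterval => E.meanDemand t i x p) x - x)) / 2

namespace Environment

variable (E : Environment n) (t : ℕ) (i : Fin n)

lemma integrable_demand (z : (Fin n → unitInterval) × unitInterval) :
    Integrable (fun d : Fin n → unitInterval => (d i : ℝ)) (E.demand t z) :=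
  Integrable.of_bound (measurable_subtype_coe.comp (measurable_pi_apply i)).aestronglyMeasurable 1
    (Filter.Eventually.of_forall fun d => by
      rw [Real.norm_eq_abs, abs_of_nonneg (d i).2.1]; exact (d i).2.2)

lemma meanDemand_mem (x p : unitInterval) : E.meanDemand t i x p ∈ Set.Icc (0 : ℝ) 1 := by
  refine ⟨integral_nonneg fun d => (d i).2.1, ?_⟩
  refine (integral_mono (E.integrable_demand t i _) (integrable_const 1) fun d => (d i).2.2).trans ?_
  simp

lemma measurable_meanDemand (p : unitInterval) :
    Measurable fun x : unitInterval => E.meanDemand t i x p := by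
  have h : StronglyMeasurable fun d : Fin n → unitInterval => (d i : ℝ) :=
    (measurable_subtype_coe.comp (measurable_pi_apply i)).stronglyMeasurable
  have h2 : Measurable fun x : unitInterval => ((fun _ : Fin n => x), p) :=
    (measurable_pi_lambda _ fun _ => measurable_id).prodMk measurable_const
  exact (h.integral_kernel (κ := E.demand t)).measurable.comp h2

lemma measurable_meanLoss (p : unitInterval) : Measurable (E.meanLoss t i p) := by
  have h : Measurable
      (Set.IccExtend zero_le_one (fun x : unitInterval => E.meanDemand t i x p) : ℝ → ℝ) :=
    (E.measurable_meanDemand t i p).comp continuous_projIcc.measurable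
  exact (((h.const_mul _).sub measurable_id).const_sub 1).div_const 2

lemma meanLoss_coe (p x : unitInterval) :
    E.meanLoss t i p x = (1 - ((p : ℝ) * E.meanDemand t i x p - x)) / 2 := by
  rw [meanLoss, Set.IccExtend_val]

lemma meanLoss_mem (p : unitInterval) {x : ℝ} (hx : x ∈ Set.Icc (0 : ℝ) 1) :
    E.meanLoss t i p x ∈ Set.Icc (0 : ℝ) 1 := by
  rw [show x = ((⟨x, hx⟩ : unitInterval) : ℝ) from rfl, meanLoss_coe]
  have hd := E.meanDemand_mem t i ⟨x, hx⟩ p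
  have h1 : 0 ≤ (p : ℝ) * E.meanDemand t i ⟨x, hx⟩ p := mul_nonneg p.2.1 hd.1
  have h2 : (p : ℝ) * E.meanDemand t i ⟨x, hx⟩ p ≤ 1 := mul_le_one₀ p.2.2 hd.1 hd.2
  have := hx.1
  have := hx.2
  constructor <;> simp only <;> linarith

/-- Negating the concave demand, scaling it by the price `p ≥ 0` and adding the linear cost
preserves convexity. -/
lemma CostConcave.convexOn_meanLoss {E : Environment n} {T : ℕ} (hE : E.CostConcave T) {t : ℕ}
    (ht : t < T) (i : Fin n) (p : unitInterval) :
    ConvexOn ℝ (Set.Icc 0 1) (E.meanLoss t i p) := by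
  have h := ((hE t ht i).1 p).neg.smul p.2.1
  have h2 : ConvexOn ℝ (Set.Icc (0 : ℝ) 1) fun x => x := convexOn_id (convex_Icc _ _)
  have h3 := ((h.add h2).add_const 1).smul (by norm_num : (0 : ℝ) ≤ 1 / 2)
  refine h3.congr fun x _ => ?_
  simp only [meanLoss, Pi.add_apply, Pi.neg_apply, smul_eq_mul]
  ring

lemma lintegral_loss (K : ℕ) (j : Fin (K + 1)) (c : Fin n → unitInterval) :
    ∫⁻ d, ENNReal.ofReal (loss ((j, c), d) i) ∂(E.demand t (c, priceLevel K j)) =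
      ENNReal.ofReal (E.meanLoss t i (priceLevel K j) (c i)) := by
  have hi : Integrable (fun d => loss (((j, c), d) : Round n K) i)
      (E.demand t (c, priceLevel K j)) := by
    simp only [loss, profit]
    exact (((integrable_const 1).sub (((E.integrable_demand t i _).const_mul _).sub
      (integrable_const _))).div_const 2)
  rw [← ofReal_integral_eq_lintegral_ofReal hi
    (Filter.Eventually.of_forall fun d => loss_nonneg _ i), meanLoss_coe]
  congr 1
  -- The demand law sees the whole vector `c`, whereas `meanDemand` is evaluated at a constant
  -- vector; locality of the mean identifies the two.
  have hm : E.meanDemand t i (c i) (priceLevel K j) =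
      ∫ d, (d i : ℝ) ∂(E.demand t (c, priceLevel K j)) :=
    E.mean_local t i _ _ _ rfl
  simp only [loss, profit]
  have h1 : Integrable (fun d : Fin n → unitInterval =>
      (priceLevel K j : ℝ) * (d i : ℝ) - (c i : ℝ)) (E.demand t (c, priceLevel K j)) :=
    ((E.integrable_demand t i _).const_mul _).sub (integrable_const _)
  rw [hm, integral_div, integral_sub (integrable_const 1) h1,
    integral_sub ((E.integrable_demand t i _).const_mul _) (integrable_const _),
    integral_const_mul]
  simp

end Environment

section RoundKernel

variable {t : ℕ} (E : Environment n)

lemma lintegral_roundKernel_eval (hP : P.Admissible) (h : Hist n K t) (i : Fin n)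
    {φ : Fin (K + 1) → ℝ → ℝ≥0∞} (hφ : ∀ j, Measurable (φ j)) :
    ∫⁻ r, φ r.1.1 (r.1.2 i) ∂(roundKernel P E K t h) =
      ∑ j, ENNReal.ofReal ((stateAt P t h).price j) * ∫⁻ x in Set.Icc (0 : ℝ) 1,
        ENNReal.ofReal ((stateAt P t h).costDens P i j x) * φ j x := by
  have := isMarkovKernel_policy hP n K t
  have hφ' : Measurable fun a : Choice n K => φ a.1 (a.2 i) := by
    have : Measurable fun z : Fin (K + 1) × ℝ => φ z.1 z.2 := measurable_from_prod_countable_right hφ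
    exact this.comp (measurable_fst.prodMk (measurable_subtype_coe.comp
      ((measurable_pi_apply i).comp measurable_snd)))
  have hm : Measurable fun r : Round n K => φ r.1.1 (r.1.2 i) := hφ'.comp measurable_fst
  rw [roundKernel, Kernel.lintegral_compProd _ _ _ hm]
  simp only [lintegral_const, measure_univ, mul_one]
  exact lintegral_policy_eval hP h i hφ

/-- The loss enters linearly, so the demand noise integrates out given the choice, and only the mean
loss remains. -/
lemma lintegral_roundKernel_loss_mul (hP : P.Admissible) (h : Hist n K t) (i : Fin n)
    {φ : Fin (K + 1) → ℝ → ℝ≥0∞} (hφ : ∀ j, Measurable (φ j)) :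
    ∫⁻ r, ENNReal.ofReal (loss r i) * φ r.1.1 (r.1.2 i) ∂(roundKernel P E K t h) =
      ∑ j, ENNReal.ofReal ((stateAt P t h).price j) * ∫⁻ x in Set.Icc (0 : ℝ) 1,
        ENNReal.ofReal ((stateAt P t h).costDens P i j x) *
          (ENNReal.ofReal (E.meanLoss t i (priceLevel K j) x) * φ j x) := by
  have := isMarkovKernel_policy hP n K t
  have hφ' : Measurable fun a : Choice n K => φ a.1 (a.2 i) := by
    have : Measurable fun z : Fin (K + 1) × ℝ => φ z.1 z.2 := measurable_from_prod_countable_right hφ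
    exact this.comp (measurable_fst.prodMk (measurable_subtype_coe.comp
      ((measurable_pi_apply i).comp measurable_snd)))
  have hm : Measurable fun r : Round n K => ENNReal.ofReal (loss r i) * φ r.1.1 (r.1.2 i) :=
    (measurable_loss i).ennreal_ofReal.mul (hφ'.comp measurable_fst)
  rw [roundKernel, Kernel.lintegral_compProd _ _ _ hm]
  have e : ∀ a : Choice n K, ∫⁻ d, ENNReal.ofReal (loss (a, d) i) * φ a.1 (a.2 i)
      ∂(E.response K t (h, a)) =
        ENNReal.ofReal (E.meanLoss t i (priceLevel K a.1) (a.2 i)) * φ a.1 (a.2 i) := by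
    intro a
    have hd : Measurable fun d => ENNReal.ofReal (loss ((a, d) : Round n K) i) :=
      ((measurable_loss i).comp measurable_prodMk_left).ennreal_ofReal
    rw [lintegral_mul_const _ hd]
    congr 1
    exact E.lintegral_loss t i K a.1 a.2
  simp only [e]
  exact lintegral_policy_eval hP h i
    (φ := fun j x => ENNReal.ofReal (E.meanLoss t i (priceLevel K j) x) * φ j x)
    fun j => (E.measurable_meanLoss t i _).ennreal_ofReal.mul (hφ j)

end RoundKernel

end TargetedMarketing

namespace TargetedMarketing

open scoped ENNReal

variable {n K : ℕ} {P : Params}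

/-! ## The conditional expectation of the gains -/

/-- A lower bound for the growth in one round of the potential
`log q_{t,0}(p) + (2 / n) ∑ i, log u_{t,i}(c i | p)`, divided by `η` and compensated by the average
loss. -/
noncomputable def State.roundGain (P : Params) (s : State n K) (c : Fin n → ℝ) (p : Fin (K + 1))
    (r : Round n K) : ℝ :=
  s.priceGain P p r + 1 / (n : ℝ) * ∑ i, (2 * s.costGain P i p (c i) r - loss r i)

/-- The observed average loss in `State.priceGain` cancels against the one subtracted in
`State.roundGain`; only importance-weighted losses survive. The factor `* 1` gives them the shape
`loss * (weight * ψ)`, whose expectation is computed in general. -/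
lemma State.roundGain_eq (s : State n K) (c : Fin n → ℝ) (p : Fin (K + 1))
    (r : Round n K) :
    s.roundGain P c p r = 3 * P.γ / (s.price p + P.γ) - 9 * P.η - 3 * P.γ * ((K : ℝ) + 1) -
      (P.γ + P.η) * (1 / (s.price r.1.1 + P.γ)) +
      1 / (n : ℝ) * ∑ i, (2 * s.costGain P i p (c i) r - loss r i * (s.weight P p r.1.1 * 1)) := by
  rw [State.roundGain, State.priceGain, Finset.sum_sub_distrib, Finset.sum_sub_distrib,
    ← Finset.sum_mul]
  ring

lemma integral_linear_combination {α : Type*} [MeasurableSpace α] {μ : Measure α}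
    {f₁ f₂ f₃ f₄ : α → ℝ} (h₁ : Integrable f₁ μ) (h₂ : Integrable f₂ μ) (h₃ : Integrable f₃ μ)
    (h₄ : Integrable f₄ μ) (a : ℝ) :
    Integrable (fun x => 2 * f₁ x - 2 * f₂ x - a * f₃ x - f₄ x) μ ∧
      ∫ x, (2 * f₁ x - 2 * f₂ x - a * f₃ x - f₄ x) ∂μ =
        2 * ∫ x, f₁ x ∂μ - 2 * ∫ x, f₂ x ∂μ - a * ∫ x, f₃ x ∂μ - ∫ x, f₄ x ∂μ := by
  have i1 : Integrable (fun x => 2 * f₁ x - 2 * f₂ x) μ := (h₁.const_mul 2).sub (h₂.const_mul 2)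
  have i2 : Integrable (fun x => 2 * f₁ x - 2 * f₂ x - a * f₃ x) μ := i1.sub (h₃.const_mul a)
  refine ⟨i2.sub h₄, ?_⟩
  rw [integral_sub i2 h₄, integral_sub i1 (h₃.const_mul a),
    integral_sub (h₁.const_mul 2) (h₂.const_mul 2), integral_const_mul, integral_const_mul,
    integral_const_mul]

section Measurability

variable {α : Type*} [MeasurableSpace α] {s : α → State n K}

lemma measurable_weight (hs : MeasurableState s) (p : Fin (K + 1)) :
    Measurable fun z : α × Round n K => (s z.1).weight P p z.2.1.1 := by
  have hj : Measurable fun z : α × Round n K => z.2.1.1 := by fun_prop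
  have hset : MeasurableSet {z : α × Round n K | z.2.1.1 = p} := hj (measurableSet_singleton p)
  exact Measurable.ite hset
    ((((hs.price p).comp measurable_fst).add_const P.γ).const_div 1) measurable_const

lemma measurable_cost (i : Fin n) : Measurable fun z : α × Round n K => (z.2.1.2 i : ℝ) :=
  measurable_subtype_coe.comp ((measurable_pi_apply i).comp
    (measurable_snd.comp (measurable_fst.comp measurable_snd)))

lemma measurable_costGain (hs : MeasurableState s) (i : Fin n) (p : Fin (K + 1)) (c : ℝ) :
    Measurable fun z : α × Round n K => (s z.1).costGain P i p c z.2 := by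
  have hl : Measurable fun z : α × Round n K => loss z.2 i := (measurable_loss i).comp measurable_snd
  have hw := measurable_weight (P := P) hs p
  have hx := measurable_cost (K := K) (α := α) i
  have hq : Measurable fun z : α × Round n K => (s z.1).costDens P i p (z.2.1.2 i) :=
    hs.costDens P i measurable_fst measurable_const hx
  have hm : Measurable fun z : α × Round n K => mean P.δ ((s z.1).dens i p) :=
    (measurable_mean (u := fun a => (s a).dens i p) (hs.dens i p)).comp measurable_fst
  have hk : Measurable fun z : α × Round n K =>
      smoothingKernel P.δ P.ε (mean P.δ ((s z.1).dens i p)) (z.2.1.2 i) c :=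
    (measurable_smoothingKernel P.δ P.ε).comp (hm.prodMk (hx.prodMk measurable_const))
  have hM : Measurable fun z : α × Round n K =>
      1 / max |(z.2.1.2 i : ℝ) - mean P.δ ((s z.1).dens i p)| P.ε :=
    ((hx.sub hm).abs.max measurable_const).const_div 1
  exact ((hl.mul (hw.mul (hq.div hq))).sub (hl.mul (hw.mul (hk.div hq)))).sub
    (((hw.pow_const 2).mul (hM.div hq)).const_mul _)

lemma measurable_roundGain (hs : MeasurableState s) (c : Fin n → ℝ) (p : Fin (K + 1)) :
    Measurable fun z : α × Round n K => (s z.1).roundGain P c p z.2 := by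
  have hj : Measurable fun z : α × Round n K => z.2.1.1 := by fun_prop
  have hl : ∀ i, Measurable fun z : α × Round n K => loss z.2 i := fun i =>
    (measurable_loss i).comp measurable_snd
  have hw := measurable_weight (P := P) hs p
  have hpr : Measurable fun z : α × Round n K => (s z.1).price z.2.1.1 :=
    hs.price_comp measurable_fst hj
  have hp : Measurable fun z : α × Round n K => (s z.1).price p := (hs.price p).comp measurable_fst
  refine Measurable.add ?_ ((Finset.measurable_fun_sum _ fun i _ =>
    ((measurable_costGain hs i p (c i)).const_mul 2).sub (hl i)).const_mul _)
  exact ((((((Finset.measurable_fun_sum _ fun i _ => hl i).const_mul _).mul (hw.const_sub 1)).sub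
    ((hpr.add_const _).const_div _)).add ((hp.add_const _).const_div _)).sub_const _).sub_const _

end Measurability

/-- The gain need not be bounded below, because of the divisions by `q`. A uniform upper bound is
enough to apply Tonelli to a constant minus the gain. -/
lemma State.roundGain_le (hP : P.Admissible) (hn : 1 ≤ n) {s : State n K} (hs : s.Regular P)
    (c : Fin n → ℝ) (p : Fin (K + 1)) (r : Round n K) :
    s.roundGain P c p r ≤ 3 + 2 / P.γ := by
  have hγ := hP.γ_pos
  have hη := hP.η_pos
  have hn' : (0 : ℝ) < n := by exact_mod_cast hn
  have hp := hs.price_pos p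
  have hj := hs.price_pos r.1.1
  rw [State.roundGain_eq]
  have h1 : 3 * P.γ / (s.price p + P.γ) ≤ 3 := by
    rw [div_le_iff₀ (by positivity)]
    linarith
  have h2 : 0 ≤ (P.γ + P.η) * (1 / (s.price r.1.1 + P.γ)) := by positivity
  have hw0 := State.weight_nonneg hP hs p r.1.1
  have hw1 : s.weight P p r.1.1 ≤ 1 / P.γ := by
    unfold State.weight
    split_ifs
    · exact one_div_le_one_div_of_le hγ (by linarith)
    · positivity
  have h3 : ∀ i, 2 * s.costGain P i p (c i) r - loss r i * (s.weight P p r.1.1 * 1) ≤ 2 / P.γ := by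
    intro i
    have hl0 := loss_nonneg r i
    have hl1 := loss_le_one r i
    have hq := hs.costDens_nonneg hP i p (r.1.2 i)
    have a1 : loss r i * (s.weight P p r.1.1 *
        (s.costDens P i p (r.1.2 i) / s.costDens P i p (r.1.2 i))) ≤ 1 / P.γ := by
      refine (mul_le_of_le_one_left (by positivity) hl1).trans ?_
      exact (mul_le_of_le_one_right hw0 (div_self_le_one _)).trans hw1
    have a2 : 0 ≤ loss r i * (s.weight P p r.1.1 *
      (smoothingKernel P.δ P.ε (mean P.δ (s.dens i p)) (r.1.2 i) (c i) /
        s.costDens P i p (r.1.2 i))) := by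
      have := smoothingKernel_nonneg hP.ε_pos (δ := P.δ) (mean P.δ (s.dens i p)) (r.1.2 i) (c i)
      positivity
    have a3 : 0 ≤ P.η / 2 * (s.weight P p r.1.1 ^ 2 *
      (1 / max |(r.1.2 i : ℝ) - mean P.δ (s.dens i p)| P.ε / s.costDens P i p (r.1.2 i))) := by
      have : 0 < max |(r.1.2 i : ℝ) - mean P.δ (s.dens i p)| P.ε := lt_max_of_lt_right hP.ε_pos
      positivity
    have a4 : 0 ≤ loss r i * (s.weight P p r.1.1 * 1) := by positivity
    have e : 2 / P.γ = 2 * (1 / P.γ) := by ring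
    rw [State.costGain, e]
    linarith
  have h4 : 1 / (n : ℝ) * ∑ i, (2 * s.costGain P i p (c i) r -
      loss r i * (s.weight P p r.1.1 * 1)) ≤ 2 / P.γ := by
    rw [one_div, inv_mul_le_iff₀ hn']
    simpa using Finset.sum_le_sum fun i (_ : i ∈ Finset.univ) => h3 i
  have h5 : 0 ≤ 3 * P.γ * ((K : ℝ) + 1) := by positivity
  linarith

section Conditional

variable {t : ℕ} (E : Environment n)

/-- Only the level `p` has nonzero weight. Its probability times the weight is `q / (q + γ) ≤ 1`,
the downward bias caused by `γ`. -/
lemma lintegral_loss_mul_weight (hP : P.Admissible) (h : Hist n K t) (i : Fin n)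
    (p : Fin (K + 1)) {ψ : ℝ → ℝ} (hψ : Measurable ψ) :
    ∫⁻ r, ENNReal.ofReal (loss r i * ((stateAt P t h).weight P p r.1.1 * ψ (r.1.2 i)))
        ∂(roundKernel P E K t h) =
      ENNReal.ofReal ((stateAt P t h).price p / ((stateAt P t h).price p + P.γ)) *
        ∫⁻ x in Set.Icc (0 : ℝ) 1, ENNReal.ofReal ((stateAt P t h).costDens P i p x *
          (E.meanLoss t i (priceLevel K p) x * ψ x)) := by
  have hs := regular_stateAt hP t h
  set s := stateAt P t h with hsdef
  have hQ := hs.price_pos p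
  have hγ := hP.γ_pos
  have e := lintegral_roundKernel_loss_mul E hP h i
    (φ := fun j x => ENNReal.ofReal (s.weight P p j * ψ x))
    fun j => (hψ.const_mul _).ennreal_ofReal
  simp only [← hsdef] at e
  simp only [ENNReal.ofReal_mul (loss_nonneg _ i), e]
  have hm : Measurable fun x => ENNReal.ofReal (s.costDens P i p x *
      (E.meanLoss t i (priceLevel K p) x * ψ x)) :=
    ((hs.measurable_costDens i p).mul ((E.measurable_meanLoss t i _).mul hψ)).ennreal_ofReal
  rw [Finset.sum_eq_single p]
  · rw [div_eq_mul_one_div, ENNReal.ofReal_mul hQ.le, mul_assoc, ← lintegral_const_mul _ hm]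
    congr 1
    refine setLIntegral_congr_fun measurableSet_Icc fun x hx => ?_
    have hl := (E.meanLoss_mem t i (priceLevel K p) hx).1
    have hw : s.weight P p p = 1 / (s.price p + P.γ) := if_pos rfl
    rw [← ENNReal.ofReal_mul hl, ← ENNReal.ofReal_mul (hs.costDens_nonneg hP i p x),
      ← ENNReal.ofReal_mul (by positivity), hw]
    congr 1
    ring
  · intro j _ hj
    have hw : s.weight P p j = 0 := if_neg hj
    simp [hw]
  · simp

lemma lintegral_weight_sq_mul (hP : P.Admissible) (h : Hist n K t) (i : Fin n)
    (p : Fin (K + 1)) {ψ : ℝ → ℝ} (hψ : Measurable ψ) :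
    ∫⁻ r, ENNReal.ofReal ((stateAt P t h).weight P p r.1.1 ^ 2 * ψ (r.1.2 i))
        ∂(roundKernel P E K t h) =
      ENNReal.ofReal ((stateAt P t h).price p / ((stateAt P t h).price p + P.γ) ^ 2) *
        ∫⁻ x in Set.Icc (0 : ℝ) 1, ENNReal.ofReal ((stateAt P t h).costDens P i p x * ψ x) := by
  have hs := regular_stateAt hP t h
  set s := stateAt P t h with hsdef
  have hQ := hs.price_pos p
  have hγ := hP.γ_pos
  have e := lintegral_roundKernel_eval E hP h i
    (φ := fun j x => ENNReal.ofReal (s.weight P p j ^ 2 * ψ x))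
    fun j => (hψ.const_mul _).ennreal_ofReal
  simp only [← hsdef] at e
  rw [e]
  have hm : Measurable fun x => ENNReal.ofReal (s.costDens P i p x * ψ x) :=
    ((hs.measurable_costDens i p).mul hψ).ennreal_ofReal
  rw [Finset.sum_eq_single p]
  · rw [div_eq_mul_one_div, ENNReal.ofReal_mul hQ.le, mul_assoc, ← lintegral_const_mul _ hm]
    congr 1
    refine setLIntegral_congr_fun measurableSet_Icc fun x hx => ?_
    have hw : s.weight P p p = 1 / (s.price p + P.γ) := if_pos rfl
    rw [← ENNReal.ofReal_mul (hs.costDens_nonneg hP i p x), ← ENNReal.ofReal_mul (by positivity),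
      hw]
    congr 1
    rw [one_div_pow]
    ring
  · intro j _ hj
    have hw : s.weight P p j = 0 := if_neg hj
    simp [hw]
  · simp

/-- Each of the `K + 1` levels contributes `q / (q + γ) ≤ 1`. -/
lemma lintegral_inv_price_le (hP : P.Admissible) (hn : 1 ≤ n) (h : Hist n K t) :
    ∫⁻ r, ENNReal.ofReal (1 / ((stateAt P t h).price r.1.1 + P.γ)) ∂(roundKernel P E K t h) ≤
      ENNReal.ofReal ((K : ℝ) + 1) := by
  have hs := regular_stateAt hP t h
  set s := stateAt P t h with hsdef
  have hγ := hP.γ_pos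
  -- The integrand ignores costs; market `0` is a dummy that lets the one-market formula apply.
  have e := lintegral_roundKernel_eval E hP h ⟨0, hn⟩
    (φ := fun j _ => ENNReal.ofReal (1 / (s.price j + P.γ))) fun j => measurable_const
  rw [← hsdef] at e
  rw [e]
  have hj : ∀ j ∈ Finset.univ, ENNReal.ofReal (s.price j) * ∫⁻ x in Set.Icc (0 : ℝ) 1,
      ENNReal.ofReal (s.costDens P ⟨0, hn⟩ j x) * ENNReal.ofReal (1 / (s.price j + P.γ)) ≤
        ENNReal.ofReal 1 := by
    intro j _
    have hQ := hs.price_pos j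
    have hc := hs.lintegral_costDens hP ⟨0, hn⟩ j
    rw [lintegral_unitInterval fun x => ENNReal.ofReal (s.costDens P ⟨0, hn⟩ j x)] at hc
    rw [lintegral_mul_const _ (hs.measurable_costDens _ j).ennreal_ofReal, hc, one_mul,
      ← ENNReal.ofReal_mul hQ.le]
    refine ENNReal.ofReal_le_ofReal ?_
    rw [mul_one_div]
    exact div_le_one_of_le₀ (by linarith) (by positivity)
  refine (Finset.sum_le_sum hj).trans (le_of_eq ?_)
  rw [← ENNReal.ofReal_sum_of_nonneg fun _ _ => zero_le_one]
  simp

/-- The expected gain of a single market, given the history. -/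
lemma le_integral_market (hP : P.Admissible) {T : ℕ} (hE : E.CostConcave T) (ht : t < T)
    (h : Hist n K t) (i : Fin n) (p : Fin (K + 1)) {c : ℝ} (hc : c ∈ Set.Icc P.δ (1 - P.δ)) :
    Integrable (fun r => 2 * (stateAt P t h).costGain P i p c r -
        loss r i * ((stateAt P t h).weight P p r.1.1 * 1)) (roundKernel P E K t h) ∧
    -E.meanLoss t i (priceLevel K p) c - 9 / 2 * (P.ε / P.δ) -
        2 * P.γ / ((stateAt P t h).price p + P.γ) ≤
      ∫ r, (2 * (stateAt P t h).costGain P i p c r -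
        loss r i * ((stateAt P t h).weight P p r.1.1 * 1)) ∂(roundKernel P E K t h) := by
  have hs := regular_stateAt hP t h
  set s := stateAt P t h with hsdef
  have hu := hs.dens i p
  have hQ := hs.price_pos p
  have hγ := hP.γ_pos
  have hη := hP.η_pos
  set Q := s.price p with hQdef
  set q := s.costDens P i p with hqdef
  set l := E.meanLoss t i (priceLevel K p) with hl
  set k : ℝ → ℝ := fun x => smoothingKernel P.δ P.ε (mean P.δ (s.dens i p)) x c with hk
  set M : ℝ → ℝ := fun x => 1 / max |x - mean P.δ (s.dens i p)| P.ε with hM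
  have hqm : Measurable q := hs.measurable_costDens i p
  have hlm : Measurable l := E.measurable_meanLoss t i _
  have hkm : Measurable k := measurable_smoothingKernel_left _ _ _ _
  have hMm : Measurable M := ((measurable_id.sub_const _).abs.max measurable_const).const_div 1
  have hq0 : ∀ x, 0 ≤ q x := hs.costDens_nonneg hP i p
  have hq1 : ∀ x, q x ≤ 1 / P.ε := hu.smoothed_le hP.ε_pos
  have hk0 : ∀ x, 0 ≤ k x := fun x => smoothingKernel_nonneg hP.ε_pos _ _ _
  have hk1 : ∀ x, k x ≤ 1 / P.ε := fun x => smoothingKernel_le_inv hP.ε_pos _ _ _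
  have hM0 : ∀ x, 0 ≤ M x := fun x =>
    div_nonneg zero_le_one (hP.ε_pos.le.trans (le_max_right _ _))
  have hM1 : ∀ x, M x ≤ 1 / P.ε := fun x =>
    one_div_le_one_div_of_le hP.ε_pos (le_max_right _ _)
  have hlb : ∀ x ∈ Set.Icc (0 : ℝ) 1, l x ∈ Set.Icc (0 : ℝ) 1 := fun x hx =>
    E.meanLoss_mem t i _ hx
  have hconv : ConvexOn ℝ (Set.Icc 0 1) l := hE.convexOn_meanLoss ht i _
  set Λ := ∫ x in Set.Icc (0 : ℝ) 1, q x * l x with hΛ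
  set ρ := Q / (Q + P.γ) with hρ
  have hρ0 : 0 ≤ ρ := by positivity
  have hρ1 : ρ ≤ 1 := div_le_one_of_le₀ (by linarith) (by positivity)
  have hΛ0 : 0 ≤ Λ := setIntegral_nonneg measurableSet_Icc fun x hx =>
    mul_nonneg (hq0 x) (hlb x hx).1
  have hbd : ∀ {g : ℝ → ℝ}, (∀ x, 0 ≤ g x) → (∀ x, g x ≤ 1 / P.ε) → Measurable g →
      IntegrableOn (fun x => g x * l x) (Set.Icc (0 : ℝ) 1) := fun {g} h0 h1 hgm =>
    integrableOn_Icc_of_bounded (hgm.mul hlm) (C := 1 / P.ε) fun x hx => by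
      rw [Pi.mul_apply, abs_of_nonneg (mul_nonneg (h0 x) (hlb x hx).1)]
      exact (mul_le_of_le_one_right (h0 x) (hlb x hx).2).trans (h1 x)
  have hql := hbd hq0 hq1 hqm
  have hkl := hbd hk0 hk1 hkm
  have hnnr : ∀ {g : ℝ → ℝ}, (∀ x, 0 ≤ g x) →
      0 ≤ᵐ[volume.restrict (Set.Icc (0 : ℝ) 1)] fun x => g x * l x := fun {g} h0 =>
    (ae_restrict_iff' measurableSet_Icc).mpr (Filter.Eventually.of_forall fun x hx =>
      mul_nonneg (h0 x) (hlb x hx).1)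
  have eF : ∫⁻ r, ENNReal.ofReal (loss r i * (s.weight P p r.1.1 * 1))
      ∂(roundKernel P E K t h) = ENNReal.ofReal (ρ * Λ) := by
    have e := lintegral_loss_mul_weight E hP h i p (ψ := fun _ => 1) measurable_const
    simp only [← hsdef] at e
    rw [e, ENNReal.ofReal_mul hρ0, ofReal_integral_eq_lintegral_ofReal hql (hnnr hq0)]
    simp only [mul_one]
    rfl
  have eA : ∫⁻ r, ENNReal.ofReal (loss r i * (s.weight P p r.1.1 *
      (q (r.1.2 i) / q (r.1.2 i)))) ∂(roundKernel P E K t h) = ENNReal.ofReal (ρ * Λ) := by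
    have e := lintegral_loss_mul_weight E hP h i p (ψ := fun x => q x / q x) (hqm.div hqm)
    simp only [← hsdef] at e
    rw [e, ENNReal.ofReal_mul hρ0, ofReal_integral_eq_lintegral_ofReal hql (hnnr hq0)]
    congr 1
    refine lintegral_congr fun x => ?_
    congr 1
    change q x * (l x * (q x / q x)) = q x * l x
    rcases eq_or_ne (q x) 0 with h0 | h0
    · simp [h0]
    · field_simp
  -- The importance weight `k / q` turns sampling from `q` into integration against the kernel,
  -- where the convexity estimate applies. Only an inequality holds, since mass at zeros of `q` is
  -- lost.
  have eB : ∫⁻ r, ENNReal.ofReal (loss r i * (s.weight P p r.1.1 *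
      (k (r.1.2 i) / q (r.1.2 i)))) ∂(roundKernel P E K t h) ≤
        ENNReal.ofReal (ρ * ((l c + Λ) / 2 + 9 / 4 * (P.ε / P.δ))) := by
    have e := lintegral_loss_mul_weight E hP h i p (ψ := fun x => k x / q x) (hkm.div hqm)
    simp only [← hsdef] at e
    rw [e, ENNReal.ofReal_mul hρ0]
    gcongr ?_ * ?_
    · exact le_rfl
    refine le_trans ?_ (ENNReal.ofReal_le_ofReal
      (hu.setIntegral_kernel_mul_le hconv hlm hlb hP.δ_pos hP.ε_pos hP.fits hc))
    rw [ofReal_integral_eq_lintegral_ofReal hkl (hnnr hk0)]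
    refine setLIntegral_mono (hkm.mul hlm).ennreal_ofReal fun x hx => ?_
    refine ENNReal.ofReal_le_ofReal ?_
    change q x * (l x * (k x / q x)) ≤ k x * l x
    have e' : q x * (l x * (k x / q x)) = q x / q x * (k x * l x) := by ring
    rw [e']
    exact mul_le_of_le_one_left (mul_nonneg (hk0 x) (hlb x hx).1) (div_self_le_one _)
  -- One factor `1 / q` is cancelled by the sampling density, leaving the integral of the envelope.
  have eD : ∫⁻ r, ENNReal.ofReal (s.weight P p r.1.1 ^ 2 * (M (r.1.2 i) / q (r.1.2 i)))
      ∂(roundKernel P E K t h) ≤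
        ENNReal.ofReal (1 / (Q + P.γ) * (2 * Real.log (Real.exp 1 / P.ε))) := by
    have e := lintegral_weight_sq_mul E hP h i p (ψ := fun x => M x / q x) (hMm.div hqm)
    simp only [← hsdef] at e
    rw [e, ENNReal.ofReal_mul (by positivity)]
    refine mul_le_mul' (ENNReal.ofReal_le_ofReal ?_) ?_
    · rw [sq, ← div_div, div_le_div_iff_of_pos_right (by positivity)]
      exact hρ1
    have hμ := hu.mean_mem hP.δ_pos.le
    refine le_trans ?_ (ENNReal.ofReal_le_ofReal (integral_inv_max_le hP.ε_pos hP.ε_le_one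
      (μ := mean P.δ (s.dens i p)) ⟨hP.δ_pos.le.trans hμ.1, hμ.2.trans (by linarith [hP.δ_pos])⟩))
    have hMi : IntegrableOn M (Set.Icc 0 1) :=
      integrableOn_Icc_of_bounded hMm (C := 1 / P.ε) fun x _ => by
        rw [abs_of_nonneg (hM0 x)]; exact hM1 x
    rw [ofReal_integral_eq_lintegral_ofReal hMi (Filter.Eventually.of_forall hM0)]
    refine lintegral_mono fun x => ENNReal.ofReal_le_ofReal ?_
    change q x * (M x / q x) ≤ M x
    have e' : q x * (M x / q x) = q x / q x * M x := by ring
    rw [e']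
    exact mul_le_of_le_one_left (hM0 x) (div_self_le_one _)
  have hms : MeasurableState fun _ : Unit => s :=
    ⟨fun _ => measurable_const, fun i j => (hs.dens i j).measurable.comp measurable_snd⟩
  have hlossm := measurable_loss (K := K) i
  have hwm : Measurable fun r : Round n K => s.weight P p r.1.1 :=
    (measurable_weight (P := P) hms p).comp (measurable_prodMk_left (x := ()))
  have hxm : Measurable fun r : Round n K => (r.1.2 i : ℝ) :=
    (measurable_cost (α := Unit) i).comp (measurable_prodMk_left (x := ()))
  have hw0 : ∀ r : Round n K, 0 ≤ s.weight P p r.1.1 := fun r => State.weight_nonneg hP hs p _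
  have mA : Measurable fun r : Round n K => loss r i * (s.weight P p r.1.1 *
      (q (r.1.2 i) / q (r.1.2 i))) := hlossm.mul (hwm.mul ((hqm.comp hxm).div (hqm.comp hxm)))
  have mB : Measurable fun r : Round n K => loss r i * (s.weight P p r.1.1 *
      (k (r.1.2 i) / q (r.1.2 i))) := hlossm.mul (hwm.mul ((hkm.comp hxm).div (hqm.comp hxm)))
  have mD : Measurable fun r : Round n K => s.weight P p r.1.1 ^ 2 * (M (r.1.2 i) / q (r.1.2 i)) :=
    (hwm.pow_const 2).mul ((hMm.comp hxm).div (hqm.comp hxm))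
  have mF : Measurable fun r : Round n K => loss r i * (s.weight P p r.1.1 * 1) :=
    hlossm.mul (hwm.mul measurable_const)
  have nA : ∀ r : Round n K, 0 ≤ loss r i * (s.weight P p r.1.1 *
      (q (r.1.2 i) / q (r.1.2 i))) := fun r =>
    mul_nonneg (loss_nonneg r i) (mul_nonneg (hw0 r) (div_nonneg (hq0 _) (hq0 _)))
  have nB : ∀ r : Round n K, 0 ≤ loss r i * (s.weight P p r.1.1 *
      (k (r.1.2 i) / q (r.1.2 i))) := fun r =>
    mul_nonneg (loss_nonneg r i) (mul_nonneg (hw0 r) (div_nonneg (hk0 _) (hq0 _)))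
  have nD : ∀ r : Round n K, 0 ≤ s.weight P p r.1.1 ^ 2 * (M (r.1.2 i) / q (r.1.2 i)) := fun r =>
    mul_nonneg (sq_nonneg _) (div_nonneg (hM0 _) (hq0 _))
  have nF : ∀ r : Round n K, 0 ≤ loss r i * (s.weight P p r.1.1 * 1) := fun r =>
    mul_nonneg (loss_nonneg r i) (mul_nonneg (hw0 r) zero_le_one)
  have iA := integrable_of_lintegral_le mA nA eA.le
  have iB := integrable_of_lintegral_le mB nB eB
  have iD := integrable_of_lintegral_le mD nD eD
  have iF := integrable_of_lintegral_le mF nF eF.le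
  have hlc := (hlb c ⟨hP.δ_pos.le.trans hc.1, hc.2.trans (by linarith [hP.δ_pos])⟩).1
  have hεδ : 0 ≤ P.ε / P.δ := div_nonneg hP.ε_pos.le hP.δ_pos.le
  have hL : 0 ≤ Real.log (Real.exp 1 / P.ε) := zero_le_one.trans hP.one_le_log
  have vA := integral_eq_of_lintegral_eq mA nA (mul_nonneg hρ0 hΛ0) eA
  have vB := integral_le_of_lintegral_le mB nB (by positivity) eB
  have vD := integral_le_of_lintegral_le mD nD (by positivity) eD
  have vF := integral_eq_of_lintegral_eq mF nF (mul_nonneg hρ0 hΛ0) eF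
  have hsplit : (fun r : Round n K => 2 * s.costGain P i p c r -
      loss r i * (s.weight P p r.1.1 * 1)) = fun r =>
      (2 * (loss r i * (s.weight P p r.1.1 * (q (r.1.2 i) / q (r.1.2 i)))) -
        2 * (loss r i * (s.weight P p r.1.1 * (k (r.1.2 i) / q (r.1.2 i)))) -
        P.η * (s.weight P p r.1.1 ^ 2 * (M (r.1.2 i) / q (r.1.2 i)))) -
        loss r i * (s.weight P p r.1.1 * 1) := by
    funext r
    simp only [State.costGain, hk, hM, hqdef]
    ring
  rw [hsplit]
  obtain ⟨hint, hval⟩ := integral_linear_combination iA iB iD iF P.η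
  refine ⟨hint, ?_⟩
  rw [hval, vA, vF]
  have hD' := mul_le_mul_of_nonneg_left vD hη.le
  have e6 : P.η * (1 / (Q + P.γ) * (2 * Real.log (Real.exp 1 / P.ε))) =
      2 * P.γ / (Q + P.γ) := by rw [hP.γ_eq]; ring
  rw [e6] at hD'
  -- The main terms combine to `2 ρ Λ - ρ (l c + Λ) - ρ Λ = -ρ l c`. As losses are nonnegative and
  -- `ρ ≤ 1`, the bias of the importance weights only helps here.
  have h7 : ρ * (l c + 9 / 2 * (P.ε / P.δ)) ≤ l c + 9 / 2 * (P.ε / P.δ) :=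
    mul_le_of_le_one_left (by positivity) hρ1
  linarith

/-- The expected gain in one round, given the history. -/
lemma le_integral_roundGain (hP : P.Admissible) (hn : 1 ≤ n) {T : ℕ} (hE : E.CostConcave T)
    (ht : t < T) (h : Hist n K t) (p : Fin (K + 1)) {c : Fin n → ℝ}
    (hc : ∀ i, c i ∈ Set.Icc P.δ (1 - P.δ)) :
    Integrable (fun r => (stateAt P t h).roundGain P c p r) (roundKernel P E K t h) ∧
    -(1 / (n : ℝ) * ∑ i, E.meanLoss t i (priceLevel K p) (c i)) -
        (4 * P.γ * ((K : ℝ) + 1) + P.η * ((K : ℝ) + 10) + 9 / 2 * (P.ε / P.δ)) ≤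
      ∫ r, (stateAt P t h).roundGain P c p r ∂(roundKernel P E K t h) := by
  have hs := regular_stateAt hP t h
  have := isMarkovKernel_roundKernel (K := K) hP E t
  have hγ := hP.γ_pos
  have hη := hP.η_pos
  have hn' : (0 : ℝ) < n := by exact_mod_cast hn
  have hmarket := fun i => le_integral_market E hP hE ht h i p (hc i)
  have e1 := lintegral_inv_price_le E hP hn h
  set s := stateAt P t h with hsdef
  have hQ := hs.price_pos p
  have mN : Measurable fun r : Round n K => 1 / (s.price r.1.1 + P.γ) :=
    (measurable_of_finite fun j : Fin (K + 1) => 1 / (s.price j + P.γ)).comp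
      (measurable_fst.comp measurable_fst)
  have nN : ∀ r : Round n K, 0 ≤ 1 / (s.price r.1.1 + P.γ) := fun r => by
    have := hs.price_pos r.1.1
    positivity
  have iN := integrable_of_lintegral_le mN nN e1
  have vN := integral_le_of_lintegral_le mN nN (by positivity) e1
  simp only [State.roundGain_eq]
  have iS := (integrable_finsetSum Finset.univ fun i _ => (hmarket i).1).const_mul (1 / (n : ℝ))
  have iC : Integrable (fun r : Round n K => 3 * P.γ / (s.price p + P.γ) - 9 * P.η -
      3 * P.γ * ((K : ℝ) + 1) - (P.γ + P.η) * (1 / (s.price r.1.1 + P.γ)))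
      (roundKernel P E K t h) := (integrable_const _).sub (iN.const_mul _)
  refine ⟨iC.add iS, ?_⟩
  rw [integral_add iC iS, integral_sub (integrable_const _) (iN.const_mul _), integral_const_mul,
    integral_const_mul, integral_finsetSum _ fun i _ => (hmarket i).1]
  simp only [integral_const, probReal_univ, one_smul]
  have hsum := Finset.sum_le_sum fun i (_ : i ∈ Finset.univ) => (hmarket i).2
  have hsum' := mul_le_mul_of_nonneg_left hsum (by positivity : 0 ≤ 1 / (n : ℝ))
  rw [Finset.sum_sub_distrib, Finset.sum_sub_distrib, Finset.sum_neg_distrib, Finset.sum_const,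
    Finset.sum_const, Finset.card_univ, Fintype.card_fin, nsmul_eq_mul, nsmul_eq_mul] at hsum'
  have e2 : 1 / (n : ℝ) * (-∑ i, E.meanLoss t i (priceLevel K p) (c i) -
      (n : ℝ) * (9 / 2 * (P.ε / P.δ)) - (n : ℝ) * (2 * P.γ / (s.price p + P.γ))) =
      -(1 / (n : ℝ) * ∑ i, E.meanLoss t i (priceLevel K p) (c i)) - 9 / 2 * (P.ε / P.δ) -
        2 * P.γ / (s.price p + P.γ) := by
    field_simp
  rw [e2] at hsum'
  have h3 := mul_le_mul_of_nonneg_left vN (by positivity : 0 ≤ P.γ + P.η)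
  -- The reserved `3 γ / (q + γ)` covers the markets' `2 γ / (q + γ)`, and the nonnegative rest is
  -- dropped.
  have h4 : 0 ≤ P.γ / (s.price p + P.γ) := by positivity
  have e5 : 3 * P.γ / (s.price p + P.γ) = 3 * (P.γ / (s.price p + P.γ)) := by ring
  have e6 : 2 * P.γ / (s.price p + P.γ) = 2 * (P.γ / (s.price p + P.γ)) := by ring
  rw [e6] at hsum'
  rw [e5]
  linarith

end Conditional

end TargetedMarketing

namespace TargetedMarketing

open scoped ENNReal

variable {n K : ℕ} {P : Params}

/-! ## Summing up over the rounds -/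

/-- Tonelli for the nonnegative function `C - G` gives integrability on the joint space from a
one-sided bound and the conditional means alone. -/
lemma integrable_and_le_integral_compProd {α β : Type*} [MeasurableSpace α] [MeasurableSpace β]
    (μ : Measure α) [IsProbabilityMeasure μ] (κ : Kernel α β) [IsMarkovKernel κ] {G : α × β → ℝ}
    (hG : Measurable G) {b C : ℝ} (hC : ∀ z, G z ≤ C)
    (hi : ∀ a, Integrable (fun x => G (a, x)) (κ a)) (hb : ∀ a, b ≤ ∫ x, G (a, x) ∂(κ a)) :
    Integrable G (μ.compProd κ) ∧ b ≤ ∫ z, G z ∂(μ.compProd κ) := by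
  have hX : Measurable fun z => C - G z := hG.const_sub C
  have h0 : ∀ z, 0 ≤ C - G z := fun z => sub_nonneg.mpr (hC z)
  have hcond : ∀ a, ∫⁻ x, ENNReal.ofReal (C - G (a, x)) ∂(κ a) ≤ ENNReal.ofReal (C - b) := by
    intro a
    have hint : Integrable (fun x => C - G (a, x)) (κ a) := (integrable_const C).sub (hi a)
    rw [← ofReal_integral_eq_lintegral_ofReal hint
      (Filter.Eventually.of_forall fun x => h0 (a, x))]
    refine ENNReal.ofReal_le_ofReal ?_
    rw [integral_sub (integrable_const C) (hi a)]
    simp only [integral_const, probReal_univ, one_smul]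
    linarith [hb a]
  have hle : ∫⁻ z, ENNReal.ofReal (C - G z) ∂(μ.compProd κ) ≤ ENNReal.ofReal (C - b) := by
    rw [Measure.lintegral_compProd hX.ennreal_ofReal]
    refine (lintegral_mono hcond).trans ?_
    simp
  -- Needed because `ENNReal.ofReal` truncates at `0`; any single point `a` shows it.
  have hbC : 0 ≤ C - b := by
    obtain ⟨a⟩ : Nonempty α := nonempty_of_isProbabilityMeasure μ
    have h1 : ∫ x, G (a, x) ∂(κ a) ≤ ∫ _, C ∂(κ a) :=
      integral_mono (hi a) (integrable_const C) fun x => hC (a, x)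
    simp only [integral_const, probReal_univ, one_smul] at h1
    linarith [hb a]
  have hiX := integrable_of_lintegral_le hX h0 hle
  have hvX := integral_le_of_lintegral_le hX h0 hbC hle
  have hGi : Integrable G (μ.compProd κ) := by
    refine ((integrable_const C).sub hiX).congr (Filter.Eventually.of_forall fun z => ?_)
    simp
  refine ⟨hGi, ?_⟩
  rw [integral_sub (integrable_const C) hGi] at hvX
  simp only [integral_const, probReal_univ, one_smul] at hvX
  linarith

lemma isProbabilityMeasure_law (hP : P.Admissible) (E : Environment n) (K : ℕ) :
    ∀ t, IsProbabilityMeasure (law P E K t)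
  | 0 => Measure.dirac.isProbabilityMeasure
  | t + 1 => by
    have := isProbabilityMeasure_law hP E K t
    have := isMarkovKernel_roundKernel (K := K) hP E t
    exact inferInstanceAs
      (IsProbabilityMeasure ((law P E K t).compProd (roundKernel P E K t)))

/-- The sum of the gains over the rounds of a history. -/
noncomputable def accGain (P : Params) (c : Fin n → ℝ) (p : Fin (K + 1)) :
    (t : ℕ) → Hist n K t → ℝ
  | 0, _ => 0
  | t + 1, h => accGain P c p t h.1 + (stateAt P t h.1).roundGain P c p h.2

lemma integral_accGain_ge (hP : P.Admissible) (hn : 1 ≤ n) (E : Environment n) {T : ℕ}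
    (hE : E.CostConcave T) (p : Fin (K + 1)) {c : Fin n → ℝ}
    (hc : ∀ i, c i ∈ Set.Icc P.δ (1 - P.δ)) :
    ∀ t ≤ T, Integrable (accGain P c p t) (law P E K t) ∧
      ∑ k ∈ Finset.range t, (-(1 / (n : ℝ) * ∑ i, E.meanLoss k i (priceLevel K p) (c i)) -
        (4 * P.γ * ((K : ℝ) + 1) + P.η * ((K : ℝ) + 10) + 9 / 2 * (P.ε / P.δ))) ≤
      ∫ h, accGain P c p t h ∂(law P E K t)
  | 0, _ => ⟨integrable_zero _ _ _, by simp [accGain]⟩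
  | t + 1, ht => by
    obtain ⟨hi, hv⟩ := integral_accGain_ge hP hn E hE p hc t (by omega)
    have := isProbabilityMeasure_law hP E K t
    have := isMarkovKernel_roundKernel (K := K) hP E t
    obtain ⟨hi2, hv2⟩ := integrable_and_le_integral_compProd (law P E K t) (roundKernel P E K t)
      (measurable_roundGain (measurableState_stateAt P n K t) c p)
      (fun z => State.roundGain_le hP hn (regular_stateAt hP t z.1) c p z.2)
      (fun h => (le_integral_roundGain E hP hn hE ht h p hc).1)
      (fun h => (le_integral_roundGain E hP hn hE ht h p hc).2)
    -- The round kernel is Markov, so appending a round does not change the law of the earlier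
    -- history.
    have hfst : (Measure.map Prod.fst ((law P E K t).compProd (roundKernel P E K t))) =
        law P E K t := Measure.fst_compProd _ _
    have hi1 : Integrable (fun z : Hist n K t × Round n K => accGain P c p t z.1)
        ((law P E K t).compProd (roundKernel P E K t)) := by
      have h := hi
      rw [← hfst] at h
      exact h.comp_measurable measurable_fst
    have hv1 : ∫ z : Hist n K t × Round n K, accGain P c p t z.1
        ∂((law P E K t).compProd (roundKernel P E K t)) =
          ∫ h, accGain P c p t h ∂(law P E K t) := by
      have h := hi.aestronglyMeasurable
      conv_rhs => rw [← hfst]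
      rw [← hfst] at h
      exact (integral_map measurable_fst.aemeasurable h).symm
    refine ⟨hi1.add hi2, ?_⟩
    rw [Finset.sum_range_succ]
    have hsplit : ∫ h, accGain P c p (t + 1) h ∂(law P E K (t + 1)) =
        ∫ z : Hist n K t × Round n K, (accGain P c p t z.1 +
          (stateAt P t z.1).roundGain P c p z.2)
          ∂((law P E K t).compProd (roundKernel P E K t)) := rfl
    rw [hsplit, integral_add hi1 hi2, hv1]
    linarith

lemma measurable_totalProfit : ∀ t, Measurable fun h : Hist n K t => totalProfit t h
  | 0 => measurable_const
  | t + 1 => by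
    have hp : ∀ i, Measurable fun r : Round n K => profit r i := fun i => by
      have : (fun r : Round n K => profit r i) = fun r => 1 - 2 * loss r i := by
        funext r
        unfold loss
        ring
      rw [this]
      exact ((measurable_loss i).const_mul 2).const_sub 1
    have h1 : Measurable fun z : Hist n K t × Round n K => totalProfit t z.1 :=
      (measurable_totalProfit t).comp measurable_fst
    exact h1.add (Finset.measurable_fun_sum _ fun i _ => (hp i).comp measurable_snd)

lemma abs_totalProfit_le : ∀ (t : ℕ) (h : Hist n K t), |totalProfit t h| ≤ n * t
  | 0, _ => by simp [totalProfit]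
  | t + 1, h => by
    have h1 := abs_totalProfit_le t h.1
    have h2 : |∑ i, profit h.2 i| ≤ n := by
      refine (Finset.abs_sum_le_sum_abs _ _).trans ?_
      simpa using Finset.sum_le_sum fun i (_ : i ∈ Finset.univ) =>
        abs_le.mpr (profit_mem h.2 i)
    simp only [totalProfit]
    push_cast
    refine (abs_add_le _ _).trans ?_
    linarith

lemma integrable_totalProfit (hP : P.Admissible) (E : Environment n) (t : ℕ) :
    Integrable (fun h : Hist n K t => totalProfit t h) (law P E K t) := by
  have := isProbabilityMeasure_law hP E K t
  exact Integrable.of_bound (measurable_totalProfit t).aestronglyMeasurable (n * t)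
    (Filter.Eventually.of_forall fun h => abs_totalProfit_le t h)

/-- The growth of the potential along a history. -/
lemma le_potential (hP : P.Admissible) (hn : 1 ≤ n) (p : Fin (K + 1)) {c : Fin n → ℝ}
    (hc : ∀ i, c i ∈ Set.Icc P.δ (1 - P.δ)) : ∀ (t : ℕ) (h : Hist n K t),
    -Real.log ((K : ℝ) + 1) +
        P.η * (accGain P c p t h + (t : ℝ) / 2 - totalProfit t h / (2 * (n : ℝ))) ≤
      Real.log ((stateAt P t h).price p) +
        2 / (n : ℝ) * ∑ i, Real.log ((stateAt P t h).dens i p (c i))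
  | 0, h => by
    -- The initial density is the constant `1 / (1 - 2 δ) ≥ 1`, so the cost part of the potential
    -- starts nonnegative.
    have hlog : ∀ i, 0 ≤ Real.log ((State.init P n K).dens i p (c i)) := fun i => by
      have h1 : 0 < 1 - 2 * P.δ := by linarith [hP.ε_pos, hP.fits]
      simp only [State.init, Set.indicator_of_mem (hc i)]
      exact Real.log_nonneg (by rw [le_div_iff₀ h1]; linarith [hP.δ_pos])
    have h2 : 0 ≤ 2 / (n : ℝ) * ∑ i, Real.log ((State.init P n K).dens i p (c i)) :=
      mul_nonneg (by positivity) (Finset.sum_nonneg fun i _ => hlog i)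
    have h3 : Real.log ((State.init P n K).price p) = -Real.log ((K : ℝ) + 1) := by
      simp only [State.init]
      rw [one_div, Real.log_inv]
    simp only [accGain, totalProfit, stateAt, h3]
    simp only [Nat.cast_zero, zero_div, add_zero, sub_zero, mul_zero]
    linarith
  | t + 1, h => by
    have hn' : (n : ℝ) ≠ 0 := by positivity
    have ih := le_potential hP hn p hc t h.1
    have hs := regular_stateAt hP t h.1
    have h1 := State.log_price_add_le hP hs h.2 p
    have h2 := Finset.sum_le_sum fun i (_ : i ∈ Finset.univ) =>
      State.log_dens_add_le hP hs h.2 i p (hc i)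
    have h2' := mul_le_mul_of_nonneg_left h2 (by positivity : 0 ≤ 2 / (n : ℝ))
    rw [Finset.sum_add_distrib, ← Finset.mul_sum] at h2'
    have hstate : stateAt P (t + 1) h = (stateAt P t h.1).update P h.2 := rfl
    have hacc : accGain P c p (t + 1) h =
      accGain P c p t h.1 + (stateAt P t h.1).roundGain P c p h.2 := rfl
    have htot : totalProfit (t + 1) h = totalProfit t h.1 + ∑ i, profit h.2 i := rfl
    have hloss : ∑ i, loss h.2 i = (n : ℝ) / 2 - (∑ i, profit h.2 i) / 2 := by
      simp only [loss]
      rw [← Finset.sum_div, Finset.sum_sub_distrib]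
      simp
      ring
    have hgain : (stateAt P t h.1).roundGain P c p h.2 = (stateAt P t h.1).priceGain P p h.2 +
        2 / (n : ℝ) * (∑ i, (stateAt P t h.1).costGain P i p (c i) h.2) - 1 / 2 +
          (∑ i, profit h.2 i) / (2 * (n : ℝ)) := by
      rw [State.roundGain, Finset.sum_sub_distrib, ← Finset.mul_sum, hloss]
      field_simp
      ring
    rw [hstate, hacc, htot, hgain]
    push_cast
    have e : P.η * (accGain P c p t h.1 + ((stateAt P t h.1).priceGain P p h.2 +
        2 / (n : ℝ) * (∑ i, (stateAt P t h.1).costGain P i p (c i) h.2) - 1 / 2 +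
          (∑ i, profit h.2 i) / (2 * (n : ℝ))) + ((t : ℝ) + 1) / 2 -
          (totalProfit t h.1 + ∑ i, profit h.2 i) / (2 * (n : ℝ))) =
        P.η * (accGain P c p t h.1 + (t : ℝ) / 2 - totalProfit t h.1 / (2 * (n : ℝ))) +
          P.η * (stateAt P t h.1).priceGain P p h.2 +
          2 / (n : ℝ) * (P.η * ∑ i, (stateAt P t h.1).costGain P i p (c i) h.2) := by
      field_simp
      ring
    rw [e]
    linarith

/-- In any interval there is a cost at which the expected density is not too large. -/
lemma exists_lintegral_dens_le (hP : P.Admissible) (E : Environment n) (t : ℕ) (i : Fin n)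
    (p : Fin (K + 1)) {a : ℝ} (ha : P.δ ≤ a) (ha' : a + P.δ ≤ 1 - P.δ) :
    ∃ c ∈ Set.Icc a (a + P.δ), ∫⁻ h, ENNReal.ofReal ((stateAt P t h).dens i p c) ∂(law P E K t) ≤
      ENNReal.ofReal (1 / P.δ) := by
  have := isProbabilityMeasure_law hP E K t
  have hδ := hP.δ_pos
  have hvol : volume (Set.Icc a (a + P.δ)) = ENNReal.ofReal P.δ := by
    rw [Real.volume_Icc, add_sub_cancel_left]
  have hm : Measurable fun z : Hist n K t × ℝ => ENNReal.ofReal ((stateAt P t z.1).dens i p z.2) :=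
    ((measurableState_stateAt P n K t).dens i p).ennreal_ofReal
  have hm' : Measurable fun z : ℝ × Hist n K t =>
      ENNReal.ofReal ((stateAt P t z.2).dens i p z.1) := hm.comp measurable_swap
  -- Some point is no worse than the average over the interval. By Tonelli that average is at most
  -- total mass `1` divided by the length `δ`.
  obtain ⟨c, hc, hle⟩ := exists_le_setLAverage (μ := volume) (s := Set.Icc a (a + P.δ))
    (f := fun c => ∫⁻ h, ENNReal.ofReal ((stateAt P t h).dens i p c) ∂(law P E K t))
    (by rw [hvol]; simpa using hδ) (by rw [hvol]; exact ENNReal.ofReal_ne_top)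
    hm'.lintegral_prod_right'.aemeasurable
  refine ⟨c, hc, hle.trans ?_⟩
  rw [setLAverage_eq, hvol, lintegral_lintegral_swap hm'.aemeasurable, one_div,
    ENNReal.ofReal_inv_of_pos hδ, ENNReal.div_eq_inv_mul]
  refine mul_le_of_le_one_right zero_le ?_
  have hin : ∀ h : Hist n K t, ∫⁻ c in Set.Icc a (a + P.δ),
      ENNReal.ofReal ((stateAt P t h).dens i p c) ≤ 1 := by
    intro h
    have hu := (regular_stateAt hP t h).dens i p
    refine (lintegral_mono_set (Set.Icc_subset_Icc ha ha')).trans ?_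
    rw [← ofReal_integral_eq_lintegral_ofReal hu.integrableOn
      (Filter.Eventually.of_forall hu.nonneg), hu.integral_eq_one, ENNReal.ofReal_one]
  refine (lintegral_mono hin).trans ?_
  simp

/-- The performance of the algorithm against costs chosen from given intervals. -/
theorem exists_costs_loss_le (hP : P.Admissible) (hn : 1 ≤ n) (E : Environment n) {T : ℕ}
    (hE : E.CostConcave T) (p : Fin (K + 1)) {a : Fin n → ℝ} (ha : ∀ i, P.δ ≤ a i)
    (ha' : ∀ i, a i + P.δ ≤ 1 - P.δ) :
    ∃ c : Fin n → ℝ, (∀ i, c i ∈ Set.Icc (a i) (a i + P.δ)) ∧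
      (T : ℝ) / 2 - (∫ h, totalProfit T h ∂(law P E K T)) / (2 * (n : ℝ)) ≤
        (Real.log ((K : ℝ) + 1) + 2 * Real.log (1 / P.δ)) / P.η +
        ∑ t ∈ Finset.range T, (1 / (n : ℝ) * ∑ i, E.meanLoss t i (priceLevel K p) (c i)) +
        (T : ℝ) * (4 * P.γ * ((K : ℝ) + 1) + P.η * ((K : ℝ) + 10) + 9 / 2 * (P.ε / P.δ)) := by
  have := isProbabilityMeasure_law hP E K T
  have hδ := hP.δ_pos
  have hη := hP.η_pos
  have hn' : (0 : ℝ) < n := by exact_mod_cast hn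
  -- The costs depend on the law of the final history but not on the history itself, so they are a
  -- legitimate fixed comparator.
  choose c hc hdens using fun i => exists_lintegral_dens_le hP E T i p (ha i) (ha' i)
  have hc' : ∀ i, c i ∈ Set.Icc P.δ (1 - P.δ) := fun i =>
    Set.Icc_subset_Icc (ha i) (ha' i) (hc i)
  refine ⟨c, hc, ?_⟩
  have hdm : ∀ i, Measurable fun h : Hist n K T => (stateAt P T h).dens i p (c i) := fun i =>
    ((measurableState_stateAt P n K T).dens i p).comp measurable_prodMk_right
  have hdn : ∀ i, ∀ h : Hist n K T, 0 ≤ (stateAt P T h).dens i p (c i) := fun i h =>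
    ((regular_stateAt hP T h).dens i p).nonneg _
  have hdi := fun i => integrable_of_lintegral_le (hdm i) (hdn i) (hdens i)
  have hdv := fun i => integral_le_of_lintegral_le (hdm i) (hdn i) (by positivity) (hdens i)
  obtain ⟨hai, hav⟩ := integral_accGain_ge hP hn E hE p hc' T le_rfl
  have hti := integrable_totalProfit (K := K) hP E T
  have hpt : ∀ h : Hist n K T,
      P.η * (accGain P c p T h + (T : ℝ) / 2 - totalProfit T h / (2 * (n : ℝ))) ≤
      (Real.log ((K : ℝ) + 1) + 2 * (Real.log (1 / P.δ) - 1)) +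
        2 / (n : ℝ) * ∑ i, P.δ * (stateAt P T h).dens i p (c i) := by
    intro h
    have hs := regular_stateAt hP T h
    have h1 := le_potential hP hn p hc' T h
    have h2 : Real.log ((stateAt P T h).price p) ≤ 0 :=
      Real.log_nonpos (hs.price_pos p).le (hs.price_le_one p)
    -- The tangent line of `log` at `1 / δ`; its linear term has expectation at most `1`, which the
    -- `-1` cancels.
    have h3 : ∀ i, Real.log ((stateAt P T h).dens i p (c i)) ≤
        P.δ * (stateAt P T h).dens i p (c i) + (Real.log (1 / P.δ) - 1) := by
      intro i
      have hpos := (hs.dens i p).pos (c i) (hc' i)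
      have := Real.log_le_sub_one_of_pos (mul_pos hδ hpos)
      rw [Real.log_mul hδ.ne' hpos.ne'] at this
      rw [one_div, Real.log_inv]
      linarith
    have h4 := mul_le_mul_of_nonneg_left (Finset.sum_le_sum fun i (_ : i ∈ Finset.univ) => h3 i)
      (by positivity : 0 ≤ 2 / (n : ℝ))
    rw [Finset.sum_add_distrib, Finset.sum_const, Finset.card_univ, Fintype.card_fin,
      nsmul_eq_mul, mul_add] at h4
    have e : 2 / (n : ℝ) * (n * (Real.log (1 / P.δ) - 1)) = 2 * (Real.log (1 / P.δ) - 1) := by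
      field_simp
    rw [e] at h4
    linarith
  have hsum : Integrable (fun h : Hist n K T => ∑ i, P.δ * (stateAt P T h).dens i p (c i))
      (law P E K T) := integrable_finsetSum _ fun i _ => (hdi i).const_mul P.δ
  have i1 : Integrable (fun h : Hist n K T => accGain P c p T h + (T : ℝ) / 2) (law P E K T) :=
    hai.add (integrable_const _)
  have i2 : Integrable (fun h : Hist n K T => totalProfit T h / (2 * (n : ℝ))) (law P E K T) :=
    hti.div_const _
  have hI := integral_mono ((i1.sub i2).const_mul P.η)
    ((integrable_const (Real.log ((K : ℝ) + 1) + 2 * (Real.log (1 / P.δ) - 1))).add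
      (hsum.const_mul (2 / (n : ℝ)))) hpt
  have eL : ∫ h, P.η * (accGain P c p T h + (T : ℝ) / 2 - totalProfit T h / (2 * (n : ℝ)))
      ∂(law P E K T) = P.η * (∫ h, accGain P c p T h ∂(law P E K T) + (T : ℝ) / 2 -
        (∫ h, totalProfit T h ∂(law P E K T)) / (2 * (n : ℝ))) := by
    have e2 : ∫ h, totalProfit T h / (2 * (n : ℝ)) ∂(law P E K T) =
        (∫ h, totalProfit T h ∂(law P E K T)) / (2 * (n : ℝ)) := integral_div _ _
    rw [integral_const_mul, integral_sub i1 i2, integral_add hai (integrable_const _), e2]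
    simp
  have eR : ∫ h, ((Real.log ((K : ℝ) + 1) + 2 * (Real.log (1 / P.δ) - 1)) +
        2 / (n : ℝ) * ∑ i, P.δ * (stateAt P T h).dens i p (c i)) ∂(law P E K T) ≤
      Real.log ((K : ℝ) + 1) + 2 * Real.log (1 / P.δ) := by
    rw [integral_add (integrable_const _) (hsum.const_mul _), integral_const_mul,
      integral_finsetSum _ fun i _ => (hdi i).const_mul P.δ]
    simp only [integral_const, probReal_univ, one_smul, integral_const_mul]
    have h5 : ∑ i, P.δ * ∫ h, (stateAt P T h).dens i p (c i) ∂(law P E K T) ≤ n := by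
      have : ∀ i ∈ Finset.univ,
          P.δ * ∫ h, (stateAt P T h).dens i p (c i) ∂(law P E K T) ≤ 1 := fun i _ => by
        have := mul_le_mul_of_nonneg_left (hdv i) hδ.le
        rwa [mul_one_div_cancel hδ.ne'] at this
      simpa using Finset.sum_le_sum this
    have h6 := mul_le_mul_of_nonneg_left h5 (by positivity : 0 ≤ 2 / (n : ℝ))
    rw [div_mul_cancel₀ _ hn'.ne'] at h6
    linarith
  have hmain := (eL.symm.le.trans hI).trans eR
  rw [Finset.sum_sub_distrib, Finset.sum_neg_distrib, Finset.sum_const, Finset.card_range,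
    nsmul_eq_mul] at hav
  have hdiv : ∫ h, accGain P c p T h ∂(law P E K T) + (T : ℝ) / 2 -
        (∫ h, totalProfit T h ∂(law P E K T)) / (2 * (n : ℝ)) ≤
      (Real.log ((K : ℝ) + 1) + 2 * Real.log (1 / P.δ)) / P.η := by
    rw [le_div_iff₀ hη]
    linarith
  linarith

end TargetedMarketing

namespace TargetedMarketing

variable {n : ℕ}

/-! ## Comparison with the best fixed choice, and the regret bounds -/

/-- Rounding a price down to a price level. -/
lemma exists_priceLevel (K : ℕ) (hK : 1 ≤ K) (p : unitInterval) :
    ∃ j : Fin (K + 1), (priceLevel K j : ℝ) ≤ p ∧ (p : ℝ) ≤ (priceLevel K j : ℝ) + 1 / K := by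
  have hK' : (0 : ℝ) < K := by exact_mod_cast hK
  have h0 : (0 : ℝ) ≤ K * p := mul_nonneg hK'.le p.2.1
  have hlt : ⌊(K : ℝ) * p⌋₊ < K + 1 := by
    rw [Nat.lt_succ_iff]
    refine Nat.floor_le_of_le ?_
    exact mul_le_of_le_one_right hK'.le p.2.2
  refine ⟨⟨_, hlt⟩, ?_, ?_⟩
  · change ((⌊(K : ℝ) * p⌋₊ : ℕ) : ℝ) / K ≤ p
    rw [div_le_iff₀ hK', mul_comm (p : ℝ)]
    exact Nat.floor_le h0
  · change (p : ℝ) ≤ ((⌊(K : ℝ) * p⌋₊ : ℕ) : ℝ) / K + 1 / K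
    rw [← add_div, le_div_iff₀ hK', mul_comm (p : ℝ)]
    exact (Nat.lt_floor_add_one _).le

/-- Lowering the price from `p` to `q` does not decrease demand, so the revenue loses at most `p - q
≤ κ` per unit of demand. This is where monotonicity in the price enters. -/
lemma Environment.CostConcave.meanLoss_le {E : Environment n} {T t : ℕ} (hE : E.CostConcave T)
    (ht : t < T) (i : Fin n) {p q : unitInterval} (x : unitInterval) {κ : ℝ} (hqp : (q : ℝ) ≤ p)
    (hpq : (p : ℝ) ≤ q + κ) :
    E.meanLoss t i q x ≤ (1 + κ - ((p : ℝ) * E.meanDemand t i x p - x)) / 2 := by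
  have h1 : E.meanDemand t i x p ≤ E.meanDemand t i x q := (hE t ht i).2 x hqp
  have hd := E.meanDemand_mem t i x p
  rw [E.meanLoss_coe]
  have h2 := mul_le_mul_of_nonneg_left h1 q.2.1
  have h3 : ((p : ℝ) - q) * E.meanDemand t i x p ≤ κ := by
    refine (mul_le_of_le_one_right (by linarith) hd.2).trans (by linarith)
  linarith

/-- Moving a cost towards the middle of `[0, 1]` increases a convex loss only slightly. -/
lemma apply_le_of_mem_shrink {l : ℝ → ℝ} (hl : ConvexOn ℝ (Set.Icc 0 1) l)
    (hb : ∀ x ∈ Set.Icc (0 : ℝ) 1, l x ∈ Set.Icc (0 : ℝ) 1) {δ x c : ℝ} (hδ : 0 < δ)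
    (hδ' : 3 * δ ≤ 1) (hx : x ∈ Set.Icc (0 : ℝ) 1)
    (hc : c ∈ Set.Icc ((1 - 3 * δ) * x + δ) ((1 - 3 * δ) * x + δ + δ)) :
    l c ≤ l x + 3 * δ := by
  -- The cost `c` is the convex combination of `x` with weight `1 - 3 δ` and of `z` with weight `3
  -- δ`, where the loss at `z` is at most `1`.
  set z := (c - (1 - 3 * δ) * x) / (3 * δ) with hz
  have h3 : 0 < 3 * δ := by positivity
  have hz0 : 0 ≤ z := div_nonneg (by linarith [hc.1]) h3.le
  have hz1 : z ≤ 1 := by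
    rw [hz, div_le_one h3]
    linarith [hc.2]
  have hcz : (1 - 3 * δ) * x + 3 * δ * z = c := by
    rw [hz]
    field_simp
    ring
  have h := hl.2 hx (Set.mem_Icc.mpr ⟨hz0, hz1⟩) (by linarith : 0 ≤ 1 - 3 * δ) h3.le (by ring)
  simp only [smul_eq_mul] at h
  rw [hcz] at h
  have h4 := mul_le_mul_of_nonneg_left (hb z ⟨hz0, hz1⟩).2 h3.le
  have h5 : (1 - 3 * δ) * l x ≤ l x := mul_le_of_le_one_left (hb x hx).1 (by linarith)
  linarith

/-- The benchmark is compared with a nearby admissible one. The factor `2 n` undoes the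
normalization of the losses and their average over markets. -/
theorem regret_le {P : Params} (hP : P.Admissible) (hδ : 3 * P.δ ≤ 1) (hn : 1 ≤ n) {K T : ℕ}
    (hK : 1 ≤ K) (E : Environment n) (hE : E.CostConcave T) :
    regret P E K T ≤ 2 * (n : ℝ) *
      ((Real.log ((K : ℝ) + 1) + 2 * Real.log (1 / P.δ)) / P.η +
        (T : ℝ) * (1 / (2 * (K : ℝ)) + 3 * P.δ +
          (4 * P.γ * ((K : ℝ) + 1) + P.η * ((K : ℝ) + 10) + 9 / 2 * (P.ε / P.δ)))) := by
  have hn' : (0 : ℝ) < n := by exact_mod_cast hn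
  rw [regret, sub_le_iff_le_add, Environment.opt]
  refine ciSup_le fun a => ?_
  obtain ⟨j, hj1, hj2⟩ := exists_priceLevel K hK a.2
  -- As the benchmark cost runs through `[0, 1]`, the left ends run through `[δ, 1 - 2 δ]`, so the
  -- intervals of length `δ` stay inside `[δ, 1 - δ]`.
  obtain ⟨c, hc, hle⟩ := exists_costs_loss_le hP hn E hE j
    (a := fun i => (1 - 3 * P.δ) * (a.1 i : ℝ) + P.δ)
    (fun i => by
      have := mul_nonneg (by linarith : 0 ≤ 1 - 3 * P.δ) (a.1 i).2.1
      linarith)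
    (fun i => by
      have := mul_le_of_le_one_right (by linarith : 0 ≤ 1 - 3 * P.δ) (a.1 i).2.2
      linarith)
  have hround : ∀ t ∈ Finset.range T,
      1 / (n : ℝ) * ∑ i, E.meanLoss t i (priceLevel K j) (c i) ≤
        1 / 2 + 1 / (2 * (K : ℝ)) + 3 * P.δ -
        (∑ i, ((a.2 : ℝ) * E.meanDemand t i (a.1 i) a.2 - (a.1 i : ℝ))) / (2 * (n : ℝ)) := by
    intro t ht
    have ht' := Finset.mem_range.mp ht
    have h1 : ∀ i ∈ Finset.univ, E.meanLoss t i (priceLevel K j) (c i) ≤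
        (1 / 2 + 1 / (2 * (K : ℝ)) + 3 * P.δ) -
          ((a.2 : ℝ) * E.meanDemand t i (a.1 i) a.2 - (a.1 i : ℝ)) / 2 := by
      intro i _
      have h2 := apply_le_of_mem_shrink (hE.convexOn_meanLoss ht' i (priceLevel K j))
        (fun x hx => E.meanLoss_mem t i _ hx) hP.δ_pos hδ (a.1 i).2 (hc i)
      have h3 := hE.meanLoss_le ht' i (a.1 i) hj1 hj2
      have e : 1 / (2 * (K : ℝ)) = 1 / K / 2 := by ring
      rw [e]
      linarith
    have h2 := mul_le_mul_of_nonneg_left (Finset.sum_le_sum h1) (by positivity : 0 ≤ 1 / (n : ℝ))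
    refine h2.trans (le_of_eq ?_)
    rw [Finset.sum_sub_distrib, Finset.sum_const, Finset.card_univ, Fintype.card_fin,
      nsmul_eq_mul, ← Finset.sum_div]
    field_simp
  have hsum := Finset.sum_le_sum hround
  rw [Finset.sum_sub_distrib, Finset.sum_const, Finset.card_range, nsmul_eq_mul,
    ← Finset.sum_div] at hsum
  set V := ∑ t ∈ Finset.range T,
    ∑ i, ((a.2 : ℝ) * E.meanDemand t i (a.1 i) a.2 - (a.1 i : ℝ)) with hV
  set W := ∫ h, totalProfit T h ∂(law P E K T) with hW
  have key : V / (2 * (n : ℝ)) - W / (2 * (n : ℝ)) ≤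
      (Real.log ((K : ℝ) + 1) + 2 * Real.log (1 / P.δ)) / P.η +
        (T : ℝ) * (1 / (2 * (K : ℝ)) + 3 * P.δ +
          (4 * P.γ * ((K : ℝ) + 1) + P.η * ((K : ℝ) + 10) + 9 / 2 * (P.ε / P.δ))) := by
    linarith
  rw [← sub_div, div_le_iff₀ (by positivity)] at key
  linarith

/-! ### The parameters tied to the horizon -/

lemma tunedParams_admissible {η : ℝ} (hη : 0 < η) {T : ℕ} (hT : 3 ≤ T) :
    (tunedParams η T).Admissible := by
  have hT' : (3 : ℝ) ≤ T := by exact_mod_cast hT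
  have hT0 : (0 : ℝ) < T := by linarith
  refine ⟨hη, by simp only [tunedParams]; positivity, by simp only [tunedParams]; positivity,
    ?_, rfl⟩
  simp only [tunedParams]
  rw [← sub_nonneg]
  have e : 1 - 1 / (T : ℝ) - (1 / (T : ℝ) + 2 * (1 / (T : ℝ) ^ 2)) =
      ((T : ℝ) ^ 2 - 2 * T - 2) / (T : ℝ) ^ 2 := by
    field_simp
    ring
  rw [e]
  exact div_nonneg (by nlinarith) (by positivity)

lemma one_le_log_of_three_le {x : ℝ} (hx : 3 ≤ x) : 1 ≤ Real.log x := by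
  rw [Real.le_log_iff_exp_le (by linarith)]
  linarith [Real.exp_one_lt_d9]

theorem regret_tunedParams_le {T K : ℕ} {η : ℝ} (E : Environment n) (hn : 1 ≤ n) (hT : 3 ≤ T)
    (hK : 1 ≤ K) (hη : 0 < η) (hE : E.CostConcave T) :
    regret (tunedParams η T) E K T ≤ 100 * ((n : ℝ) * η * (K : ℝ) * (T : ℝ) * Real.log (T : ℝ)
      + (n : ℝ) / η * Real.log ((K : ℝ) * (T : ℝ)) + (n : ℝ) * (T : ℝ) / (K : ℝ)) := by
  have hT' : (3 : ℝ) ≤ T := by exact_mod_cast hT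
  have hT0 : (0 : ℝ) < T := by linarith
  have hK' : (1 : ℝ) ≤ K := by exact_mod_cast hK
  have hn' : (0 : ℝ) < n := by exact_mod_cast hn
  have hP := tunedParams_admissible hη hT
  have h := regret_le hP (by
    change 3 * (1 / (T : ℝ)) ≤ 1
    rw [mul_one_div]
    exact div_le_one_of_le₀ hT' hT0.le) hn hK E hE
  refine h.trans ?_
  set L := Real.log (T : ℝ) with hL
  have hL1 : 1 ≤ L := one_le_log_of_three_le hT'
  have hγ : (tunedParams η T).γ = η * (1 + 2 * L) := by
    simp only [tunedParams]
    rw [Real.log_div (Real.exp_ne_zero _) (by positivity), Real.log_exp, one_div, Real.log_inv,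
      Real.log_pow]
    push_cast
    ring
  rw [hγ]
  simp only [tunedParams]
  have hlogT : Real.log (1 / (1 / (T : ℝ))) = L := by rw [one_div_one_div]
  rw [hlogT]
  set L' := Real.log ((K : ℝ) * (T : ℝ)) with hL'
  have hLL' : L ≤ L' := Real.log_le_log hT0 (by nlinarith)
  have hKL' : Real.log ((K : ℝ) + 1) ≤ L' := Real.log_le_log (by linarith) (by nlinarith)
  have e1 : 1 / (T : ℝ) ^ 2 / (1 / (T : ℝ)) = 1 / T := by field_simp
  rw [e1]
  set S1 := η * K * T * L with hS1
  set S2 := L' / η with hS2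
  set S3 := (T : ℝ) / K with hS3
  have hS3' : 0 ≤ S3 := by positivity
  have hS1' : 0 ≤ S1 := by positivity
  have hS2' : 0 ≤ S2 := div_nonneg (by linarith) hη.le
  -- This absorbs the constant `15 / 2`, which stems from `T * (3 δ + 9 / 2 * (ε / δ))`, without any
  -- restriction on `η`.
  have hsum : 1 ≤ S1 + S2 := by
    rcases le_total 1 η with h1 | h1
    · have : (1 : ℝ) ≤ S1 := by
        rw [hS1]
        exact one_le_mul_of_one_le_of_one_le (one_le_mul_of_one_le_of_one_le
          (one_le_mul_of_one_le_of_one_le h1 hK') (by linarith)) hL1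
      linarith
    · have : (1 : ℝ) ≤ S2 := by
        rw [hS2, le_div_iff₀ hη]
        linarith
      linarith
  have hA : (Real.log ((K : ℝ) + 1) + 2 * L) / η ≤ 3 * S2 := by
    rw [hS2, ← mul_div_assoc]
    gcongr
    linarith
  have hB : (T : ℝ) * (1 / (2 * (K : ℝ)) + 3 * (1 / T) +
      (4 * (η * (1 + 2 * L)) * ((K : ℝ) + 1) + η * ((K : ℝ) + 10) + 9 / 2 * (1 / T))) =
      S3 / 2 + 15 / 2 + η * T * (4 * (1 + 2 * L) * ((K : ℝ) + 1) + (K + 10)) := by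
    rw [hS3]
    field_simp
    ring
  have hC : η * T * (4 * (1 + 2 * L) * ((K : ℝ) + 1) + (K + 10)) ≤ 35 * S1 := by
    -- The left side expands to `8 K L + 8 L + 5 K + 14`, and `L`, `K` and `1` are each at most `K
    -- L`.
    have h2 : 4 * (1 + 2 * L) * ((K : ℝ) + 1) + (K + 10) ≤ 35 * (K * L) := by
      have hKL : (K : ℝ) ≤ K * L := le_mul_of_one_le_right (by linarith) hL1
      have hLK : L ≤ K * L := le_mul_of_one_le_left (by linarith) hK'
      nlinarith
    have := mul_le_mul_of_nonneg_left h2 (by positivity : 0 ≤ η * T)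
    refine this.trans (le_of_eq ?_)
    rw [hS1]
    ring
  rw [hB]
  have e2 : 100 * ((n : ℝ) * η * K * T * L + n / η * L' + n * T / K) =
      2 * n * (50 * (S1 + S2 + S3)) := by
    rw [hS1, hS2, hS3]
    ring
  rw [e2]
  refine mul_le_mul_of_nonneg_left ?_ (by positivity)
  linarith

end TargetedMarketing

/-! ### The two regret bounds -/

theorem theorem3 :
    (∃ C : ℝ, 0 < C ∧
      ∀ (n T K : ℕ) (η : ℝ) (E : TargetedMarketing.Environment n),
        1 ≤ n → 3 ≤ T → 1 ≤ K → 0 < η → E.CostConcave T →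
        TargetedMarketing.regret (TargetedMarketing.tunedParams η T) E K T ≤
          C * ((n : ℝ) * η * (K : ℝ) * (T : ℝ) * Real.log (T : ℝ)
            + (n : ℝ) / η * Real.log ((K : ℝ) * (T : ℝ))
            + (n : ℝ) * (T : ℝ) / (K : ℝ))) ∧
    (∀ a A b B : ℝ, 0 < a → 0 < b →
      ∃ C : ℝ, 0 < C ∧
        ∀ (n T K : ℕ) (η : ℝ) (E : TargetedMarketing.Environment n),
          1 ≤ n → 3 ≤ T →
          a * (T : ℝ) ^ (1 / 3 : ℝ) ≤ (K : ℝ) → (K : ℝ) ≤ A * (T : ℝ) ^ (1 / 3 : ℝ) →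
          b * (T : ℝ) ^ (-(2 / 3) : ℝ) ≤ η → η ≤ B * (T : ℝ) ^ (-(2 / 3) : ℝ) →
          E.CostConcave T →
          TargetedMarketing.regret (TargetedMarketing.tunedParams η T) E K T ≤
            C * (n : ℝ) * (T : ℝ) ^ (2 / 3 : ℝ) * Real.log (T : ℝ)) := by
  refine ⟨⟨100, by norm_num, fun n T K η E hn hT hK hη hE =>
    TargetedMarketing.regret_tunedParams_le E hn hT hK hη hE⟩, fun a A b B ha hb => ?_⟩
  -- The three summands match the three terms of the general bound. Absolute values keep the
  -- constant positive even when `A` or `B` is not, in which case the hypotheses on `K` or `η`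
  -- cannot be met.
  refine ⟨100 * (|A| * |B| + (|Real.log A| + 2) / b + 1 / a), by positivity, ?_⟩
  intro n T K η E hn hT haK hKA hbη hηB hE
  have hT' : (3 : ℝ) ≤ T := by exact_mod_cast hT
  have hT0 : (0 : ℝ) < T := by linarith
  have hn' : (0 : ℝ) < n := by exact_mod_cast hn
  -- In terms of the cube root `X` all powers of `T` become integer powers.
  set X := (T : ℝ) ^ (1 / 3 : ℝ) with hX
  have hX0 : 0 < X := Real.rpow_pos_of_pos hT0 _
  have hX1 : 1 ≤ X := Real.one_le_rpow (by linarith) (by norm_num)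
  have hX3 : (T : ℝ) = X ^ 3 := by
    rw [hX, ← Real.rpow_natCast, ← Real.rpow_mul hT0.le]
    norm_num
  have hX2 : (T : ℝ) ^ (2 / 3 : ℝ) = X ^ 2 := by
    rw [hX, ← Real.rpow_natCast, ← Real.rpow_mul hT0.le]
    norm_num
  have hXn : (T : ℝ) ^ (-(2 / 3) : ℝ) = 1 / X ^ 2 := by
    rw [Real.rpow_neg hT0.le, hX2, one_div]
  rw [hXn] at hbη hηB
  rw [hX2]
  have hη : 0 < η := lt_of_lt_of_le (by positivity) hbη
  have hK0 : (0 : ℝ) < K := lt_of_lt_of_le (by positivity) haK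
  have hK : 1 ≤ K := by exact_mod_cast hK0
  have hA : 0 < A := pos_of_mul_pos_left (hK0.trans_le hKA) hX0.le
  have hB : 0 < B := pos_of_mul_pos_left (hη.trans_le hηB) (by positivity)
  have h := TargetedMarketing.regret_tunedParams_le E hn hT hK hη hE
  refine h.trans ?_
  set L := Real.log (T : ℝ) with hL
  have hL1 : 1 ≤ L := TargetedMarketing.one_le_log_of_three_le hT'
  have h1 : η * K * T * L ≤ |A| * |B| * (X ^ 2 * L) := by
    rw [abs_of_pos hA, abs_of_pos hB]
    have : η * K ≤ B * (1 / X ^ 2) * (A * X) :=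
      mul_le_mul hηB hKA hK0.le (by positivity)
    calc η * K * T * L ≤ B * (1 / X ^ 2) * (A * X) * T * L := by gcongr
      _ = A * B * (X ^ 2 * L) := by
        rw [hX3]
        field_simp
  have h2 : 1 / η * Real.log ((K : ℝ) * T) ≤ (|Real.log A| + 2) / b * (X ^ 2 * L) := by
    have hXT : X ≤ T := by
      rw [hX3]
      exact le_self_pow₀ hX1 (by norm_num)
    have hKT : (K : ℝ) * T ≤ A * (T * T) := by
      have : (K : ℝ) ≤ A * T := hKA.trans (mul_le_mul_of_nonneg_left hXT hA.le)
      nlinarith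
    have hlog : Real.log ((K : ℝ) * T) ≤ (|Real.log A| + 2) * L := by
      refine (Real.log_le_log (by positivity) hKT).trans ?_
      rw [Real.log_mul hA.ne' (by positivity), Real.log_mul hT0.ne' hT0.ne']
      have h3 : Real.log A ≤ |Real.log A| * L :=
        (le_abs_self _).trans (le_mul_of_one_le_right (abs_nonneg _) hL1)
      rw [← hL]
      linarith
    have hinv : 1 / η ≤ X ^ 2 / b := by
      have := one_div_le_one_div_of_le (by positivity) hbη
      refine this.trans (le_of_eq ?_)
      field_simp
    have hlog0 : 0 ≤ (|Real.log A| + 2) * L := by positivity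
    calc 1 / η * Real.log ((K : ℝ) * T) ≤ 1 / η * ((|Real.log A| + 2) * L) := by gcongr
      _ ≤ X ^ 2 / b * ((|Real.log A| + 2) * L) := by gcongr
      _ = (|Real.log A| + 2) / b * (X ^ 2 * L) := by ring
  have h3 : (T : ℝ) / K ≤ 1 / a * (X ^ 2 * L) := by
    calc (T : ℝ) / K ≤ X ^ 3 / (a * X) := by rw [hX3]; gcongr
      _ = 1 / a * (X ^ 2 * 1) := by field_simp
      _ ≤ 1 / a * (X ^ 2 * L) := by gcongr
  have e1 : 100 * ((n : ℝ) * η * K * T * L + n / η * Real.log ((K : ℝ) * T) + n * T / K) =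
      100 * n * (η * K * T * L + 1 / η * Real.log ((K : ℝ) * T) + T / K) := by ring
  have e2 : 100 * (|A| * |B| + (|Real.log A| + 2) / b + 1 / a) * n * X ^ 2 * L =
      100 * n * (|A| * |B| * (X ^ 2 * L) + (|Real.log A| + 2) / b * (X ^ 2 * L) +
        1 / a * (X ^ 2 * L)) := by ring
  rw [e1, e2]
  gcongr
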